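/- All graphs are finite, undirected and loopless, and may have parallel edges; $|E(\cdot)|$ and degrees count edges with multiplicity. An $H$-immersion model in $G$ is a pair $(\phi,\psi)$ where $\phi$ is an injection $V(H)\to V(G)$ and $\psi$ sends each edge of $H$ with ends $u,v$ to a path of $G$ between $\phi(u)$ and $\phi(v)$, distinct edges being sent to edge-disjoint paths. The corresponding $H$-immersion expansion is the subgraph of $G$ with vertex set $\phi(V(H))\cup\bigcup_{e}V(\psi(e))$ and edge set $\bigcup_{e}E(\psi(e))$. Let $\mathrm{pack}_H(G)$ be the maximum number of pairwise edge-disjoint $H$-immersion expansions in $G$ (an $H$-packing), and $\mathrm{cover}_H(G)$ the minimum size of a set $C\subseteq E(G)$ such that $G\setminus C$ has no $H$-immersion model (an $H$-cover). A rooted tree-cut decomposition of $G$ consists of a finite rooted tree $T$ and pairwise disjoint, possibly empty sets $X_t\subseteq V(G)$, $t\in V(T)$, with union $V(G)$. The adhesion of a node $t$ is the number of edges of $G$ with exactly one end in the union of the $X_w$ over the descendants $w$ of $t$ (including $t$). The torso at $t$ is obtained from $G$ by consolidating, for each component $T'$ of $T-t$, the set $\bigcup_{b\in V(T')}X_b$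 into a single vertex, edges inside such a set being discarded. Its 3-center is obtained by exhaustively deleting vertices outside $X_t$ of degree at most one and suppressing vertices outside $X_t$ of degree two (replacing the vertex and its two edges by one edge between its neighbours, or by nothing if both edges lead to the same neighbour). The width of the decomposition is the maximum, over all nodes $t$, of the adhesion of $t$ and the number of vertices of the 3-center of the torso at $t$; the tree-cut width $\mathrm{tcw}(G)$ is the minimum width of a rooted tree-cut decomposition of $G$. Theorem. Let $H$ be a connected graph with at least one edge, let $r\in\mathbb{N}$, and let $G$ be a graph with $\mathrm{tcw}(G)\le r$. Then $$\mathrm{cover}_H(G)\le \sigma(r)\cdot\bigl(4|V(H)|+|E(H)|\bigr)\cdot\mathrm{pack}_H(G),\qquad \sigma(r)=\left\lceil\frac{3(r+1)^4+2(r+1)^2}{8}\right\rceil .$$ In particular, for every $k\in\mathbb{N}$, either $G$ has an $H$-packing of size $k$, or $G$ has an $H$-cover of size at most $\sigma(r)\cdot(4|V(H)|+|E(H)|)\cdot k$. -/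

import Mathlib

/-! Multigraphs are Mathlib's `Graph α β`: a vertex set, an edge set, and an incidence relation. -/

namespace Graph

universe u v u' v'

variable {α : Type u} {β : Type v} {α' : Type u'} {β' : Type v'}

/-! ### Walks, paths, connectivity -/

/-- Walks in a multigraph, recording the edges that are traversed. -/
inductive Walk (G : Graph α β) : α → α → Type (max u v)
  | nil (x : α) (hx : x ∈ G.vertexSet) : Walk G x x
  | cons {x y z : α} (e : β) (h : G.IsLink e x y) (p : Walk G y z) : Walk G x z

namespace Walk

variable {G : Graph α β}

/-- The list of vertices visited by a walk. -/
def support : {x y : α} → G.Walk x y → List α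
  | _, _, nil x _ => [x]
  | _, _, @cons _ _ _ x _ _ _ _ p => x :: p.support

/-- The list of edges traversed by a walk. -/
def edges : {x y : α} → G.Walk x y → List β
  | _, _, nil _ _ => []
  | _, _, cons e _ p => e :: p.edges

end Walk

/-- A path of a multigraph: a walk that visits no vertex twice. -/
structure PathIn (G : Graph α β) where
  /-- one end of the path -/
  src : α
  /-- the other end of the path -/
  tgt : α
  /-- the underlying walk -/
  walk : G.Walk src tgt
  nodup : walk.support.Nodup

/-- The set of vertices of a path. -/
def PathIn.vertices {G : Graph α β} (p : G.PathIn) : Set α := {x | x ∈ p.walk.support}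

/-- The set of edges of a path. -/
def PathIn.edges {G : Graph α β} (p : G.PathIn) : Set β := {e | e ∈ p.walk.edges}

/-- A graph is connected if it has a vertex and any two of its vertices are joined by a walk. -/
def IsConnected (G : Graph α β) : Prop :=
  G.vertexSet.Nonempty ∧ ∀ x ∈ G.vertexSet, ∀ y ∈ G.vertexSet, Nonempty (G.Walk x y)

/-! ### Immersions, packings, covers -/

/-- An `H`-immersion model in `G`: an injection `φ` of the vertices, and for every edge `e` of `H`
with ends `x, y` a path `ψ e` of `G` between `φ x` and `φ y`, the paths being pairwise
edge-disjoint. -/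
structure ImmersionModel (H : Graph α' β') (G : Graph α β) where
  /-- the branch vertices -/
  φ : H.vertexSet ↪ G.vertexSet
  /-- the certifying paths -/
  ψ : H.edgeSet → G.PathIn
  ends : ∀ (e : H.edgeSet) (x y : H.vertexSet), H.IsLink e x y →
    s((ψ e).src, (ψ e).tgt) = s((φ x : α), (φ y : α))
  edgeDisjoint : ∀ e f : H.edgeSet, e ≠ f → Disjoint (ψ e).edges (ψ f).edges

/-- `G` contains `H` as an immersion. -/
def ContainsImmersion (H : Graph α' β') (G : Graph α β) : Prop :=
  Nonempty (ImmersionModel H G)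

/-- `M` is an `H`-immersion expansion in `G`: the subgraph of `G` formed by the branch vertices and
the certifying paths of some `H`-immersion model. -/
def IsImmersionExpansion (H : Graph α' β') (G M : Graph α β) : Prop :=
  M ≤ G ∧ ∃ m : ImmersionModel H G,
    M.vertexSet = Set.range (fun x => (m.φ x : α)) ∪ ⋃ e, (m.ψ e).vertices ∧
    M.edgeSet = ⋃ e, (m.ψ e).edges

/-- An `H`-cover of `G`: a set of edges whose deletion destroys all immersions of `H`. -/
def IsImmersionCover (H : Graph α' β') (G : Graph α β) (C : Set β) : Prop :=
  C ⊆ G.edgeSet ∧ ¬ ContainsImmersion H (G.deleteEdges C)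

/-- An `H`-packing in `G`: a collection of pairwise edge-disjoint `H`-immersion expansions. -/
def IsImmersionPacking (H : Graph α' β') (G : Graph α β) (P : Finset (Graph α β)) : Prop :=
  (∀ M ∈ P, IsImmersionExpansion H G M) ∧
    ∀ M ∈ P, ∀ N ∈ P, M ≠ N → Disjoint M.edgeSet N.edgeSet

/-- The maximum size of an `H`-packing in `G`. -/
noncomputable def packNum (H : Graph α' β') (G : Graph α β) : ℕ :=
  sSup {n | ∃ P : Finset (Graph α β), IsImmersionPacking H G P ∧ P.card = n}

/-- The minimum size of an `H`-cover of `G`. -/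
noncomputable def coverNum (H : Graph α' β') (G : Graph α β) : ℕ :=
  sInf {n | ∃ C : Set β, IsImmersionCover H G C ∧ C.ncard = n}

/-! ### The 3-center

Degrees count incident edges with multiplicity. -/

/-- The graph obtained by deleting `v` and merging the edges `e` and `f` at `v` into a single edge
(named `e`) between their other ends; if the other ends coincide, then no edge is added, since
graphs are loopless. -/
def suppress (G : Graph α β) (v : α) (e f : β) : Graph α β where
  vertexSet := G.vertexSet \ {v}
  IsLink g x y := x ≠ v ∧ y ≠ v ∧ (G.IsLink g x y ∨
    (g = e ∧ x ≠ y ∧ ((G.IsLink e v x ∧ G.IsLink f v y) ∨ (G.IsLink e v y ∧ G.IsLink f v x))))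
  isLink_symm := by
    intro g _
    refine ⟨fun x y h => ?_⟩
    obtain ⟨hx, hy, h | ⟨rfl, hne, h⟩⟩ := h
    · exact ⟨hy, hx, Or.inl h.symm⟩
    · exact ⟨hy, hx, Or.inr ⟨rfl, hne.symm, h.symm⟩⟩
  eq_or_eq_of_isLink_of_isLink := by
    rintro g x y z w ⟨hx, hy, h | ⟨rfl, hne, h⟩⟩ ⟨hz, hw, h' | ⟨h1, hne', h'⟩⟩
    · exact h.left_eq_or_eq h'
    · subst h1
      rcases h' with ⟨h', -⟩ | ⟨h', -⟩ <;>
        rcases h'.left_eq_or_eq h with h2 | h2 <;> simp_all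
    · rcases h with ⟨h, -⟩ | ⟨h, -⟩ <;>
        rcases h.left_eq_or_eq h' with h2 | h2 <;> simp_all
    · rcases h with ⟨h, k⟩ | ⟨h, k⟩ <;> rcases h' with ⟨h', k'⟩ | ⟨h', k'⟩
      · exact Or.inl (h.right_unique h')
      · exact Or.inr (h.right_unique h')
      · exact Or.inr (k.right_unique k')
      · exact Or.inl (k.right_unique k')
  left_mem_of_isLink := by
    rintro g x y ⟨hx, hy, h | ⟨rfl, hne, ⟨h, k⟩ | ⟨h, k⟩⟩⟩
    · exact ⟨h.left_mem, hx⟩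
    · exact ⟨h.right_mem, hx⟩
    · exact ⟨k.right_mem, hx⟩

/-- One reduction step towards the 3-center of `(G, X)`: delete a vertex outside `X` of degree at
most one, or suppress a vertex outside `X` of degree two. -/
inductive CenterStep (X : Set α) (G : Graph α β) : Graph α β → Prop
  | delete (v : α) (hv : v ∈ G.vertexSet) (hX : v ∉ X) (hdeg : (G.incidenceSet v).encard ≤ 1) :
      CenterStep X G (G.deleteVerts {v})
  | suppress (v : α) (hv : v ∈ G.vertexSet) (hX : v ∉ X) (e f : β) (hef : e ≠ f)
      (hinc : G.incidenceSet v = {e, f}) :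
      CenterStep X G (G.suppress v e f)

/-- `C` is the 3-center of `(G, X)`: it arises from `G` by reduction steps, carried out
exhaustively. -/
def IsThreeCenter (X : Set α) (G C : Graph α β) : Prop :=
  Relation.ReflTransGen (CenterStep X) G C ∧ ∀ C', ¬ CenterStep X C C'

/-- The number of vertices of the 3-center of `(G, X)`. (The 3-center is unique up to the names of
its edges, so the set below has exactly one element when `G` is finite.) -/
noncomputable def threeCenterCard (X : Set α) (G : Graph α β) : ℕ :=
  sInf {n | ∃ C, IsThreeCenter X G C ∧ C.vertexSet.ncard = n}

/-! ### Tree-cut decompositions -/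

/-- A rooted tree-cut decomposition, with nodes `ι`. The near-partition of the vertex set into
(possibly empty) bags indexed by the nodes is given by the map sending a vertex to the node whose
bag contains it; values of that map outside the vertex set are irrelevant. -/
structure TreeCutDecomposition (G : Graph α β) (ι : Type) where
  /-- the tree -/
  tree : SimpleGraph ι
  isTree : tree.IsTree
  /-- the root -/
  root : ι
  /-- the node whose bag contains a given vertex -/
  node : α → ι

namespace TreeCutDecomposition

variable {G : Graph α β} {ι : Type} (D : G.TreeCutDecomposition ι)

/-- The bag of a node. -/
def bag (t : ι) : Set α := {x ∈ G.vertexSet | D.node x = t}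

/-- The descendants of a node `t`: the nodes `w` such that the path from `w` to the root
contains `t`. -/
def desc (t : ι) : Set ι := {w | ∃ p : D.tree.Walk w D.root, p.IsPath ∧ t ∈ p.support}

/-- The adhesion of a node `t`: the number of edges with exactly one end in the union of the bags
of the descendants of `t`. -/
noncomputable def adhesion (t : ι) : ℕ :=
  {e | ∃ x y, G.IsLink e x y ∧ D.node x ∈ D.desc t ∧ D.node y ∉ D.desc t}.ncard

open Classical in
/-- The map that fixes the vertices of the bag of `t` and sends any other vertex to the component of
the tree minus `t` that contains its node. -/
noncomputable def torsoMap (t : ι) (x : α) :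
    α ⊕ (D.tree.induce {t}ᶜ).ConnectedComponent :=
  if h : D.node x = t then Sum.inl x
  else Sum.inr ((D.tree.induce {t}ᶜ).connectedComponentMk ⟨D.node x, h⟩)

/-- The torso at `t`: for every component of the tree minus `t`, the union of its bags is
consolidated into a single vertex. Edges inside a consolidated set disappear. -/
noncomputable def torso (t : ι) :
    Graph (α ⊕ (D.tree.induce {t}ᶜ).ConnectedComponent) β where
  vertexSet := Sum.inl '' D.bag t ∪ Set.range Sum.inr
  IsLink e a b := a ≠ b ∧ ∃ x y, G.IsLink e x y ∧ D.torsoMap t x = a ∧ D.torsoMap t y = b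
  isLink_symm := by
    intro e _
    refine ⟨?_⟩
    rintro a b ⟨hne, x, y, h, hx, hy⟩
    exact ⟨hne.symm, y, x, h.symm, hy, hx⟩
  eq_or_eq_of_isLink_of_isLink := by
    rintro e a b c d ⟨-, x, y, h, rfl, rfl⟩ ⟨-, z, w, h', rfl, rfl⟩
    rcases h.left_eq_or_eq h' with rfl | rfl
    · exact Or.inl rfl
    · exact Or.inr rfl
  left_mem_of_isLink := by
    rintro e a b ⟨-, x, y, h, rfl, -⟩
    by_cases hx : D.node x = t
    · exact Or.inl ⟨x, ⟨h.left_mem, hx⟩, by simp [torsoMap, hx]⟩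
    · exact Or.inr ⟨_, by rw [torsoMap, dif_neg hx]⟩

/-- The width of a tree-cut decomposition: the largest adhesion or size of the 3-center of a
torso. -/
noncomputable def width [Fintype ι] : ℕ :=
  Finset.univ.sup fun t =>
    max (D.adhesion t) (threeCenterCard (Sum.inl '' D.bag t) (D.torso t))

end TreeCutDecomposition

/-- The tree-cut width of a graph: the minimum width of its tree-cut decompositions. -/
noncomputable def treeCutWidth (G : Graph α β) : ℕ :=
  sInf {w | ∃ (ι : Type) (_ : Fintype ι) (D : G.TreeCutDecomposition ι), D.width = w}

/-- The function `σ(r) = ⌈(3(r+1)^4 + 2(r+1)^2)/8⌉`. -/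
def tcwGap (r : ℕ) : ℕ := ⌈((3 * (r + 1) ^ 4 + 2 * (r + 1) ^ 2 : ℕ) : ℚ) / 8⌉₊

end Graph

/-! The proof is greedy. Suppose every subgraph `G'` of `G` containing an immersion of `H` has a
model `m` and a set `S` of at most K edges such that every model surviving in `G' - S` is
edge-disjoint from `m`. Packing `m`, deleting `S` and repeating gives k + 1 edge-disjoint expansions
or a cover of size at most K k (`exists_packing_or_cover`). Disjointness is certified through
connectivity of `H`: a surviving model cannot leave a region whose boundary is deleted, so an edge
of `m` is safe once it has an end in such a region containing no immersion
(`ImmersionModel.disjoint_edges_of_boundary_subset`).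

To find `m` and `S` (`exists_model_and_cut`), take a node `t` with fewest descendants such that the
bags below `t` contain an immersion. Proper descendants then give regions without immersions and
with boundary at most r. The rest of the torso at `t` consists of the 3-center, with at most r
vertices, and of classes of removed vertices, each with at most two boundary edges
(`CenterStep.encard_boundary_classAvoiding_le`).

If no class contains an immersion below `t`, any model below `t` works
(`exists_cut_of_isThreeCenter`): it meets few edges at the bag and at the surviving components, and
it enters a class only through one of these. Otherwise, stop the reduction at the first step that
creates a class containing an immersion; this class becomes harmless after cutting around it, around
the component just removed, and around the bags below `t` (`exists_cut_of_centerStep`). Either way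
the number of deleted edges is linear in |E(H)| and quadratic in r, which fits under the stated
bound (`le_tcwGap_mul`). -/

namespace Graph
-- Descendants and components of the decomposition tree.
namespace TreeCutDecomposition

open SimpleGraph

variable {α β : Type*} {G : Graph α β} {ι : Type} (D : G.TreeCutDecomposition ι)

/-- `w` lies in the component `c` of the tree minus `t`. -/
def InComp (t : ι) (c : (D.tree.induce {t}ᶜ).ConnectedComponent) (w : ι) : Prop :=
  ∃ h : w ∈ ({t}ᶜ : Set ι), (D.tree.induce {t}ᶜ).connectedComponentMk ⟨w, h⟩ = c

lemma _root_.SimpleGraph.reachable_induce_compl_iff {T : SimpleGraph ι} {t u w : ι}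
    (hu : u ∈ ({t}ᶜ : Set ι)) (hw : w ∈ ({t}ᶜ : Set ι)) :
    (T.induce {t}ᶜ).Reachable ⟨u, hu⟩ ⟨w, hw⟩ ↔ ∃ p : T.Walk u w, t ∉ p.support := by
  constructor
  · rintro ⟨p⟩
    have key : ∀ {a b} (_ : (T.induce {t}ᶜ).Walk a b), ∃ q : T.Walk a.1 b.1, t ∉ q.support := by
      intro a b p
      induction p with
      | nil =>
        rename_i a
        exact ⟨SimpleGraph.Walk.nil, by simpa using fun h => a.2 h.symm⟩
      | cons h _ ih =>
        rename_i a v _ _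
        obtain ⟨q, hq⟩ := ih
        have h' : T.Adj a.1 v.1 := h
        exact ⟨SimpleGraph.Walk.cons h' q, by
          rw [SimpleGraph.Walk.support_cons, List.mem_cons]
          rintro (h | h)
          exacts [a.2 h.symm, hq h]⟩
    exact key p
  · rintro ⟨p, hp⟩
    exact ⟨p.induce ({t}ᶜ : Set ι) fun x hx h => hp (Set.mem_singleton_iff.1 h ▸ hx)⟩

variable {D}

/-- Uniqueness of paths in a tree turns one path into all walks, and walks can be concatenated
without checking for repetitions. -/
lemma mem_desc_iff {t w : ι} : w ∈ D.desc t ↔ ∀ p : D.tree.Walk w D.root, t ∈ p.support := by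
  classical
  constructor
  · rintro ⟨p, hp, ht⟩ q
    have h := (D.isTree.existsUnique_path w D.root).unique hp q.bypass_isPath
    exact q.support_bypass_subset_support (h ▸ ht)
  · intro h
    obtain ⟨p⟩ := D.isTree.1.preconnected w D.root
    exact ⟨p.bypass, p.bypass_isPath, h _⟩

lemma self_mem_desc (t : ι) : t ∈ D.desc t := mem_desc_iff.2 fun p => p.start_mem_support

lemma desc_root : D.desc D.root = Set.univ :=
  Set.eq_univ_of_forall fun _ => mem_desc_iff.2 fun p => p.end_mem_support

lemma InComp.trans_iff {t u w : ι} {c : (D.tree.induce {t}ᶜ).ConnectedComponent}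
    (hu : D.InComp t c u) (hw : w ≠ t) :
    D.InComp t c w ↔ ∃ p : D.tree.Walk w u, t ∉ p.support := by
  obtain ⟨hu, rfl⟩ := hu
  rw [← reachable_induce_compl_iff hw hu]
  exact ⟨fun ⟨h, h'⟩ => ConnectedComponent.exact h', fun h => ⟨hw, ConnectedComponent.sound h⟩⟩

/-- This makes the adhesion of `t` itself count the edges leaving the component that contains the
root. -/
lemma mem_desc_iff_of_root {t : ι} {c : (D.tree.induce {t}ᶜ).ConnectedComponent}
    (hc : D.InComp t c D.root) (w : ι) : w ∈ D.desc t ↔ ¬ D.InComp t c w := by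
  by_cases hw : w = t
  · subst hw
    exact ⟨fun _ h => h.1 rfl, fun _ => self_mem_desc w⟩
  · rw [hc.trans_iff hw, mem_desc_iff]
    push Not
    rfl

lemma mem_desc_of_inComp {t : ι} {c : (D.tree.induce {t}ᶜ).ConnectedComponent}
    (hc : ¬ D.InComp t c D.root) {w : ι} (hw : D.InComp t c w) : w ∈ D.desc t := by
  rw [mem_desc_iff]
  intro p
  by_contra ht
  refine hc ((hw.trans_iff (ne_of_mem_of_not_mem p.end_mem_support ht)).2
    ⟨p.reverse, by simpa using ht⟩)

/-- A component of the tree minus `t` that avoids the root is the set of descendants of a node. -/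
lemma exists_desc_eq_of_not_root {t : ι} {c : (D.tree.induce {t}ᶜ).ConnectedComponent}
    (hc : ¬ D.InComp t c D.root) :
    ∃ s, D.desc s ⊂ D.desc t ∧ ∀ w, w ∈ D.desc s ↔ D.InComp t c w := by
  classical
  obtain ⟨w₀, hw₀⟩ : ∃ w, D.InComp t c w := by
    induction c using ConnectedComponent.ind with
    | h v => exact ⟨v, v.2, rfl⟩
  have hw₀t : w₀ ≠ t := hw₀.1
  have huniq : ∀ {u v : ι} {p q : D.tree.Walk u v}, p.IsPath → q.IsPath → p = q :=
    fun hp hq => (D.isTree.existsUnique_path _ _).unique hp hq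
  obtain ⟨p₀, hp₀, -⟩ := D.isTree.existsUnique_path w₀ t
  have hnil : ¬ p₀.Nil := Walk.not_nil_of_ne hw₀t
  -- The required node is the neighbour of `t` in `c`, reached as the last node before `t` on the
  -- path from `w₀`.
  obtain ⟨s, hst, p₁, ht₁⟩ : ∃ s, D.tree.Adj s t ∧ ∃ p₁ : D.tree.Walk w₀ s, t ∉ p₁.support := by
    refine ⟨p₀.penultimate, p₀.adj_penultimate hnil, p₀.dropLast, fun h => ?_⟩
    have h1 := hp₀.support_nodup
    rw [← Walk.support_dropLast_concat hnil, List.nodup_append] at h1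
    exact h1.2.2 t h t (by simp) rfl
  have hs : D.InComp t c s := (hw₀.trans_iff hst.ne).2 ⟨p₁.reverse, by simpa using ht₁⟩
  obtain ⟨q, hq, -⟩ := D.isTree.existsUnique_path t D.root
  -- Otherwise `s` would be the second node of the path from `t` to the root, and the remainder of
  -- that path would put the root into `c`.
  have hsq : s ∉ q.support := by
    intro h
    have h1 : q.takeUntil s h = SimpleGraph.Walk.cons hst.symm SimpleGraph.Walk.nil :=
      huniq (hq.takeUntil h) (by simp [hst.ne'])
    have h2 : t ∉ (q.dropUntil s h).support := by
      intro h3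
      have h4 := hq.support_nodup
      rw [← q.take_spec h, h1] at h4
      simp only [SimpleGraph.Walk.cons_append, SimpleGraph.Walk.nil_append,
        SimpleGraph.Walk.support_cons, List.nodup_cons] at h4
      exact h4.1 h3
    have h5 : D.root ≠ t := ne_of_mem_of_not_mem (SimpleGraph.Walk.end_mem_support _) h2
    exact hc ((hs.trans_iff h5).2 ⟨(q.dropUntil s h).reverse, by simpa using h2⟩)
  have key : ∀ w, w ∈ D.desc s ↔ D.InComp t c w := by
    intro w
    constructor
    · intro hw
      obtain ⟨p, hp, -⟩ := D.isTree.existsUnique_path w t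
      have h1 := mem_desc_iff.1 hw (p.append q)
      rw [Walk.mem_support_append_iff] at h1
      have h2 : s ∈ p.support := h1.resolve_right hsq
      have h3 : t ∉ (p.takeUntil s h2).support :=
        Walk.endpoint_notMem_support_takeUntil hp h2 hst.ne'
      have hwt : w ≠ t := ne_of_mem_of_not_mem (SimpleGraph.Walk.start_mem_support _) h3
      exact (hs.trans_iff hwt).2 ⟨_, h3⟩
    · intro hw
      rw [mem_desc_iff]
      intro p
      by_contra hsp
      have htp : t ∈ p.support := mem_desc_iff.1 (mem_desc_of_inComp hc hw) p
      obtain ⟨p', hp'⟩ := (hs.trans_iff hw.1).1 hw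
      have h1 : (p'.bypass.concat hst).IsPath :=
        p'.bypass_isPath.concat (fun h => hp' (p'.support_bypass_subset_support h)) hst
      have h2 := huniq h1 (p.takeUntil t htp).bypass_isPath
      have h3 : s ∈ (p'.bypass.concat hst).support := by
        simp [Walk.support_concat]
      rw [h2] at h3
      exact hsp (p.support_takeUntil_subset_support htp (Walk.support_bypass_subset_support _ h3))
  refine ⟨s, ⟨fun w hw => mem_desc_of_inComp hc ((key w).1 hw), fun h => ?_⟩, key⟩
  exact ((key t).1 (h (self_mem_desc t))).1 rfl

end TreeCutDecomposition
end Graph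

namespace Graph

variable {α β : Type*}

/-! ### Edge boundaries -/

/-- The edges with exactly one end in `S`. -/
def boundary (G : Graph α β) (S : Set α) : Set β := {e | ∃ x y, G.IsLink e x y ∧ x ∈ S ∧ y ∉ S}

lemma boundary_subset_edgeSet (G : Graph α β) (S : Set α) : G.boundary S ⊆ G.edgeSet := by
  rintro e ⟨x, y, h, -⟩
  exact h.edge_mem

/-- The vertices reachable from `a` by a walk all of whose vertices, except possibly `a`, avoid
`K`. -/
def classAvoiding (G : Graph α β) (K : Set α) (a : α) : Set α :=
  {b | Relation.ReflTransGen (fun x y => G.Adj x y ∧ y ∉ K) a b}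

lemma mem_classAvoiding_self (G : Graph α β) (K : Set α) (a : α) : a ∈ G.classAvoiding K a :=
  Relation.ReflTransGen.refl

lemma notMem_of_mem_classAvoiding {G : Graph α β} {K : Set α} {a b : α} (ha : a ∉ K)
    (h : b ∈ G.classAvoiding K a) : b ∉ K := by
  cases h with
  | refl => exact ha
  | tail _ h => exact h.2

lemma mem_classAvoiding_of_adj {G : Graph α β} {K : Set α} {a b c : α}
    (h : b ∈ G.classAvoiding K a) (hbc : G.Adj b c) (hc : c ∉ K) : c ∈ G.classAvoiding K a :=
  Relation.ReflTransGen.tail h ⟨hbc, hc⟩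

/-- The defining relation is not symmetric, since only the later vertices must avoid `K`; a walk can
be reversed once its start avoids `K` too. -/
lemma classAvoiding_eq_of_mem {G : Graph α β} {K : Set α} {a b : α} (ha : a ∉ K)
    (h : b ∈ G.classAvoiding K a) : G.classAvoiding K b = G.classAvoiding K a := by
  have hsymm : a ∈ G.classAvoiding K b := by
    induction h with
    | refl => exact mem_classAvoiding_self G K a
    | tail hxy hyz ih =>
      exact Relation.ReflTransGen.head ⟨hyz.1.symm, notMem_of_mem_classAvoiding ha hxy⟩ ih
  ext c
  exact ⟨fun hc => Relation.ReflTransGen.trans h hc,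
    fun hc => Relation.ReflTransGen.trans hsymm hc⟩

lemma classAvoiding_anti {G : Graph α β} {K K' : Set α} (hK : K' ⊆ K) (a : α) :
    G.classAvoiding K a ⊆ G.classAvoiding K' a :=
  fun _ h => Relation.ReflTransGen.mono (fun _ _ h => ⟨h.1, fun h' => h.2 (hK h')⟩) _ _ h

/-- Both ends of a boundary edge of a class are known: one in the class, one in `K`. -/
lemma mem_boundary_classAvoiding {G : Graph α β} {K : Set α} {a : α} {e : β}
    (h : e ∈ G.boundary (G.classAvoiding K a)) :
    ∃ x y, G.IsLink e x y ∧ x ∈ G.classAvoiding K a ∧ y ∈ K := by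
  obtain ⟨x, y, hxy, hx, hy⟩ := h
  exact ⟨x, y, hxy, hx, by_contra fun hyK => hy (mem_classAvoiding_of_adj hx hxy.adj hyK)⟩

/-! ### Reduction to the 3-center -/

lemma CenterStep.exists_vertexSet_eq {X : Set α} {Z Z' : Graph α β} (h : CenterStep X Z Z') :
    ∃ v ∈ Z.vertexSet, v ∉ X ∧ Z'.vertexSet = Z.vertexSet \ {v} := by
  cases h with
  | delete v hv hX _ => exact ⟨v, hv, hX, vertexSet_deleteVerts _ _⟩
  | suppress v hv hX e f _ _ => exact ⟨v, hv, hX, rfl⟩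

lemma CenterStep.vertexSet_subset {X : Set α} {Z Z' : Graph α β}
    (h : Relation.ReflTransGen (CenterStep X) Z Z') : Z'.vertexSet ⊆ Z.vertexSet := by
  induction h with
  | refl => exact subset_rfl
  | tail _ h ih =>
    obtain ⟨v, -, -, h'⟩ := h.exists_vertexSet_eq
    rw [h']
    exact Set.sdiff_subset.trans ih

lemma CenterStep.subset_vertexSet {X : Set α} {Z Z' : Graph α β}
    (h : Relation.ReflTransGen (CenterStep X) Z Z') (hX : X ⊆ Z.vertexSet) :
    X ⊆ Z'.vertexSet := by
  induction h with
  | refl => exact hX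
  | tail _ h ih =>
    obtain ⟨v, -, hv, h'⟩ := h.exists_vertexSet_eq
    rw [h']
    exact Set.subset_sdiff_singleton ih hv

lemma exists_isThreeCenter (X : Set α) (Z : Graph α β) (hZ : Z.vertexSet.Finite) :
    ∃ C, IsThreeCenter X Z C := by
  induction hn : Z.vertexSet.ncard using Nat.strong_induction_on generalizing Z with
  | _ n ih =>
    by_cases h : ∃ Z', CenterStep X Z Z'
    · obtain ⟨Z', hZ'⟩ := h
      obtain ⟨v, hv, -, hV⟩ := hZ'.exists_vertexSet_eq
      have hlt : Z'.vertexSet.ncard < n := by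
        rw [hV, ← hn]
        exact Set.ncard_sdiff_singleton_lt_of_mem hv hZ
      obtain ⟨C, hC, hC'⟩ := ih _ hlt Z' (hV ▸ hZ.sdiff) rfl
      exact ⟨C, .head hZ' hC, hC'⟩
    · push Not at h
      exact ⟨Z, .refl, h⟩

lemma exists_isThreeCenter_ncard_eq (X : Set α) (Z : Graph α β) (hZ : Z.vertexSet.Finite) :
    ∃ C, IsThreeCenter X Z C ∧ C.vertexSet.ncard = threeCenterCard X Z := by
  obtain ⟨C, hC⟩ := exists_isThreeCenter X Z hZ
  exact Nat.sInf_mem (s := {n | ∃ C, IsThreeCenter X Z C ∧ C.vertexSet.ncard = n}) ⟨_, C, hC, rfl⟩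

/-- `S` is a set of vertices of `Z` avoiding `K` that all edges leave towards `K`, and at most two
edges leave `S`. -/
structure IsTwoSeparated (Z : Graph α β) (K S : Set α) : Prop where
  subset : S ⊆ Z.vertexSet
  disjoint : ∀ x ∈ S, x ∉ K
  mem_of_isLink : ∀ {e x y}, Z.IsLink e x y → x ∈ S → y ∉ K → y ∈ S
  encard_le : (Z.boundary S).encard ≤ 2

/-- The common shape of the two reduction steps: `v` is removed, and if `v` has two edges `e` and
`f` to distinct neighbours, then these are replaced by one edge named `e`. -/
lemma IsTwoSeparated.exists_of_reduction {Z Z₁ : Graph α β} {K : Set α} {v : α} {e f : β}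
    (hv : v ∈ Z.vertexSet) (hvK : v ∉ K) (hloop : ∀ e x, ¬ Z.IsLink e x x)
    (hV : Z₁.vertexSet = Z.vertexSet \ {v})
    (hlink : ∀ {g x y}, Z.IsLink g x y → x ≠ v → y ≠ v → Z₁.IsLink g x y)
    (hinc : ∀ {g x}, Z.IsLink g v x → g = e ∨ g = f)
    (hef : ∀ {x y}, Z.IsLink e v x → Z.IsLink f v y → e = f ∨ x = y ∨ Z₁.IsLink e x y)
    (ih : ∀ a ∈ Z₁.vertexSet, a ∉ K → ∃ S, IsTwoSeparated Z₁ K S ∧ a ∈ S) (a : α)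
    (ha : a ∈ Z.vertexSet) (haK : a ∉ K) : ∃ S, IsTwoSeparated Z K S ∧ a ∈ S := by
  have hvS : ∀ {S}, IsTwoSeparated Z₁ K S → v ∉ S := fun hS h => by
    have := hS.subset h
    rw [hV] at this
    exact this.2 rfl
  have hsub : ∀ {S}, IsTwoSeparated Z₁ K S → S ⊆ Z.vertexSet := fun hS x h => by
    have := hS.subset h
    rw [hV] at this
    exact this.1
  -- Distinct neighbours of `v` are joined in `Z₁` by the merged edge, so a closed set of `Z₁`
  -- containing one of them contains the other or the other lies in `K`.
  have hnbr : ∀ {g h x y}, Z.IsLink g v x → Z.IsLink h v y → x = y ∨ (g ≠ h ∧ Z₁.IsLink e x y) := by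
    intro g h x y hg hh
    by_cases hgh : g = h
    · subst hgh
      exact Or.inl (hg.right_unique hh)
    rcases hinc hg with rfl | rfl <;> rcases hinc hh with rfl | rfl
    · exact absurd rfl hgh
    · exact ((hef hg hh).resolve_left hgh).imp_right fun h => ⟨hgh, h⟩
    · exact ((hef hh hg).resolve_left (Ne.symm hgh)).imp Eq.symm fun h => ⟨hgh, h.symm⟩
    · exact absurd rfl hgh
  have hins : ∀ {S g x}, IsTwoSeparated Z₁ K S → Z.IsLink g v x → x ∈ S →
      IsTwoSeparated Z K (insert v S) := by
    intro S g x hS hg hx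
    refine ⟨Set.insert_subset hv (hsub hS), ?_, ?_, ?_⟩
    · rintro y (rfl | hy)
      exacts [hvK, hS.disjoint y hy]
    · rintro h y z hh hy hz
      by_cases hzv : z = v
      · exact Or.inl hzv
      by_cases hyv : y = v
      · subst hyv
        rcases hnbr hg hh with rfl | ⟨-, h'⟩
        exacts [Or.inr hx, Or.inr (hS.mem_of_isLink h' hx hz)]
      · exact Or.inr (hS.mem_of_isLink (hlink hh hyv hzv) (hy.resolve_left hyv) hz)
    -- Putting `v` back can only create the boundary edge `f`, and only when the merged edge `e` was
    -- on the boundary in `Z₁` and now runs inside `insert v S`. The exchange of `e` for `f` keeps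
    -- the count.
    · have hb : ∀ h ∈ Z.boundary (insert v S), h ∈ Z₁.boundary S ∨
          (h = f ∧ e ∈ Z₁.boundary S ∧ e ∉ Z.boundary (insert v S)) := by
        rintro h ⟨y, z, hh, hy, hz⟩
        have hzv : z ≠ v := fun h => hz (Or.inl h)
        have hzS : z ∉ S := fun h => hz (Or.inr h)
        by_cases hyv : y = v
        · subst hyv
          rcases hnbr hg hh with rfl | ⟨hgh, h'⟩
          · exact absurd hx hzS
          · have he : e ∈ Z₁.boundary S := ⟨x, z, h', hx, hzS⟩
            rcases hinc hh with rfl | rfl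
            · exact Or.inl he
            · refine Or.inr ⟨rfl, he, ?_⟩
              obtain rfl := (hinc hg).resolve_right hgh
              rintro ⟨y', z', hg', hy', hz'⟩
              rcases hg'.right_eq_or_eq hg with rfl | rfl
              exacts [hz' (Or.inl rfl), hz' (Or.inr hx)]
        · exact Or.inl ⟨y, z, hlink hh hyv hzv, hy.resolve_left hyv, hzS⟩
      by_cases he : e ∈ Z₁.boundary S ∧ e ∉ Z.boundary (insert v S)
      · have h1 : Z.boundary (insert v S) ⊆ insert f (Z₁.boundary S \ {e}) := by
          intro h hh
          rcases hb h hh with h' | ⟨rfl, -⟩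
          · exact Or.inr ⟨h', fun h'' => he.2 (h'' ▸ hh)⟩
          · exact Or.inl rfl
        calc (Z.boundary (insert v S)).encard ≤ (Z₁.boundary S \ {e}).encard + 1 :=
              (Set.encard_le_encard h1).trans (Set.encard_insert_le _ _)
          _ = (Z₁.boundary S).encard := Set.encard_sdiff_singleton_add_one he.1
          _ ≤ 2 := hS.encard_le
      · refine (Set.encard_le_encard fun h hh => ?_).trans hS.encard_le
        exact (hb h hh).resolve_right fun h' => he h'.2
  have hstay : ∀ {S}, IsTwoSeparated Z₁ K S → (∀ g x, Z.IsLink g v x → x ∉ S) →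
      IsTwoSeparated Z K S := by
    intro S hS hno
    have hl : ∀ {h y z}, Z.IsLink h y z → y ∈ S → Z₁.IsLink h y z := fun hh hy =>
      hlink hh (ne_of_mem_of_not_mem hy (hvS hS))
        (by rintro rfl; exact hno _ _ hh.symm hy)
    refine ⟨hsub hS, hS.disjoint, fun hh hy hz => hS.mem_of_isLink (hl hh hy) hy hz,
      (Set.encard_le_encard ?_).trans hS.encard_le⟩
    rintro h ⟨y, z, hh, hy, hz⟩
    exact ⟨y, z, hl hh hy, hy, hz⟩
  by_cases hav : a = v
  · subst hav
    by_cases hx : ∃ g x, Z.IsLink g a x ∧ x ∉ K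
    · obtain ⟨g, x, hg, hxK⟩ := hx
      have hxV : x ∈ Z₁.vertexSet := by
        rw [hV]
        exact ⟨hg.right_mem, by rintro rfl; exact hloop _ _ hg⟩
      obtain ⟨S, hS, hxS⟩ := ih x hxV hxK
      exact ⟨_, hins hS hg hxS, Set.mem_insert _ _⟩
    -- All neighbours of `v` are in `K`, so `v` alone is a closed set, and its only edges are `e`
    -- and `f`.
    · push Not at hx
      refine ⟨{a}, ⟨by simpa using ha, by simpa using haK, ?_, ?_⟩, rfl⟩
      · rintro g x y hg rfl hy
        exact absurd (hx g y hg) hy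
      · refine (Set.encard_le_encard ?_).trans
          (Set.encard_insert_le {f} e |>.trans (by simp [one_add_one_eq_two]))
        rintro g ⟨x, y, hg, rfl, -⟩
        exact hinc hg
  · obtain ⟨S, hS, haS⟩ := ih a (by rw [hV]; exact ⟨ha, hav⟩) haK
    by_cases hx : ∃ g x, Z.IsLink g v x ∧ x ∈ S
    · obtain ⟨g, x, hg, hx⟩ := hx
      exact ⟨_, hins hS hg hx, Or.inr haS⟩
    · push Not at hx
      exact ⟨S, hstay hS hx, haS⟩

lemma CenterStep.loopless {X : Set α} {Z Z' : Graph α β} (h : CenterStep X Z Z')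
    (hloop : ∀ e x, ¬ Z.IsLink e x x) : ∀ e x, ¬ Z'.IsLink e x x := by
  intro g x hg
  cases h with
  | delete v _ _ _ => exact hloop g x (deleteVerts_le.isLink_mono hg)
  | suppress v _ _ e f _ _ =>
    obtain ⟨-, -, h | ⟨-, h, -⟩⟩ := hg
    exacts [hloop g x h, h rfl]

/-- Deletion is treated as the degenerate reduction with `e = f`, so both kinds of step are undone
by the same argument. -/
lemma CenterStep.exists_isTwoSeparated {X K : Set α} {Z Z₁ : Graph α β} (h : CenterStep X Z Z₁)
    (hK : K ⊆ Z₁.vertexSet) (hloop : ∀ e x, ¬ Z.IsLink e x x)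
    (ih : ∀ a ∈ Z₁.vertexSet, a ∉ K → ∃ S, IsTwoSeparated Z₁ K S ∧ a ∈ S) (a : α)
    (ha : a ∈ Z.vertexSet) (haK : a ∉ K) : ∃ S, IsTwoSeparated Z K S ∧ a ∈ S := by
  cases h with
  | delete v hv hX hdeg =>
    have hV := vertexSet_deleteVerts Z {v}
    have hvK : v ∉ K := fun h => by
      have := hK h
      rw [hV] at this
      exact this.2 rfl
    -- A vertex of degree zero has no edge to serve as `e`; any edge name does, if there is one.
    rcases isEmpty_or_nonempty β with hβ | ⟨⟨g₀⟩⟩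
    · exact ⟨{a}, ⟨by simpa using ha, by simpa using haK, fun {e} => hβ.elim e,
        by simp [Set.eq_empty_of_isEmpty]⟩, rfl⟩
    obtain ⟨g, hg⟩ : ∃ g, Z.incidenceSet v ⊆ {g} := by
      rcases Set.encard_le_one_iff_eq.1 hdeg with h | ⟨g, h⟩
      exacts [⟨g₀, h ▸ Set.empty_subset _⟩, ⟨g, h.subset⟩]
    exact IsTwoSeparated.exists_of_reduction (e := g) (f := g) hv hvK hloop hV
      (fun h hx hy => by simp [h, hx, hy]) (fun h => Or.inl (hg ⟨_, h⟩)) (fun _ _ => Or.inl rfl)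
      ih a ha haK
  | suppress v hv hX e f hef hinc =>
    have hvK : v ∉ K := fun h => (hK h).2 rfl
    have hlink : ∀ {g x y}, Z.IsLink g x y → x ≠ v → y ≠ v → (Z.suppress v e f).IsLink g x y :=
      fun h hx hy => ⟨hx, hy, Or.inl h⟩
    refine IsTwoSeparated.exists_of_reduction (e := e) (f := f) hv hvK hloop rfl
      hlink (fun {g x} h => ?_) (fun {x y} hx hy => ?_) ih a ha haK
    · have : g ∈ Z.incidenceSet v := ⟨_, h⟩
      rwa [hinc] at this
    · by_cases hxy : x = y
      · exact Or.inr (Or.inl hxy)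
      · exact Or.inr (Or.inr ⟨by rintro rfl; exact hloop _ _ hx, by rintro rfl; exact hloop _ _ hy,
          Or.inr ⟨rfl, hxy, Or.inl ⟨hx, hy⟩⟩⟩)

lemma CenterStep.exists_isTwoSeparated_of_reflTransGen {X : Set α} {Z C : Graph α β}
    (h : Relation.ReflTransGen (CenterStep X) Z C) (hloop : ∀ e x, ¬ Z.IsLink e x x) (a : α)
    (ha : a ∈ Z.vertexSet) (haC : a ∉ C.vertexSet) :
    ∃ S, IsTwoSeparated Z C.vertexSet S ∧ a ∈ S := by
  induction h using Relation.ReflTransGen.head_induction_on generalizing a with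
  | refl => exact absurd ha haC
  | head h h' ih =>
    exact h.exists_isTwoSeparated (vertexSet_subset h') hloop (ih (h.loopless hloop)) a ha haC

/-- Each component of what was removed on the way to the 3-center sends at most two edges to the
rest. -/
lemma CenterStep.encard_boundary_classAvoiding_le {X : Set α} {Z C : Graph α β}
    (h : Relation.ReflTransGen (CenterStep X) Z C) (hloop : ∀ e x, ¬ Z.IsLink e x x) {a : α}
    (ha : a ∈ Z.vertexSet) (haC : a ∉ C.vertexSet) :
    (Z.boundary (Z.classAvoiding C.vertexSet a)).encard ≤ 2 := by
  obtain ⟨S, hS, haS⟩ := exists_isTwoSeparated_of_reflTransGen h hloop a ha haC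
  have hsub : Z.classAvoiding C.vertexSet a ⊆ S := by
    intro b hb
    induction hb with
    | refl => exact haS
    | tail _ h ih =>
      obtain ⟨⟨e, he⟩, h⟩ := h
      exact hS.mem_of_isLink he ih h
  refine (Set.encard_le_encard fun e he => ?_).trans hS.encard_le
  obtain ⟨x, y, hxy, hx, hy⟩ := mem_boundary_classAvoiding he
  exact ⟨x, y, hxy, hsub hx, fun h => hS.disjoint y h hy⟩

end Graph

namespace Graph

variable {α β α' β' : Type*}

lemma _root_.Set.encard_biUnion_le_mul {κ γ : Type*} (t : Finset κ) (s : κ → Set γ) (n : ℕ)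
    (h : ∀ i ∈ t, (s i).encard ≤ n) : (⋃ i ∈ t, s i).encard ≤ (t.card * n : ℕ) := by
  refine (Finset.set_encard_biUnion_le t s).trans ((Finset.sum_le_card_nsmul t _ _ h).trans ?_)
  simp

/-! ### Walks -/

namespace Walk

variable {G G' : Graph α β}

/-- A walk of a subgraph is a walk of the graph. -/
def ofLE (h : G' ≤ G) : {x y : α} → G'.Walk x y → G.Walk x y
  | _, _, nil x hx => nil x (h.vertexSet_mono hx)
  | _, _, cons e he p => cons e (he.mono h) (p.ofLE h)

@[simp] lemma support_ofLE (h : G' ≤ G) {x y : α} (p : G'.Walk x y) :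
    (p.ofLE h).support = p.support := by
  induction p with
  | nil => rfl
  | cons e he p ih => simp [ofLE, support, ih]

@[simp] lemma edges_ofLE (h : G' ≤ G) {x y : α} (p : G'.Walk x y) :
    (p.ofLE h).edges = p.edges := by
  induction p with
  | nil => rfl
  | cons e he p ih => simp [ofLE, edges, ih]

lemma start_mem_support {x y : α} (p : G.Walk x y) : x ∈ p.support := by
  cases p <;> simp [support]

lemma end_mem_support {x y : α} (p : G.Walk x y) : y ∈ p.support := by
  induction p with
  | nil => simp [support]
  | cons e he p ih => exact List.mem_cons_of_mem _ ih

lemma mem_vertexSet_of_mem_support {x y z : α} (p : G.Walk x y) (hz : z ∈ p.support) :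
    z ∈ G.vertexSet := by
  induction p with
  | nil x hx =>
    obtain rfl := List.mem_singleton.1 hz
    exact hx
  | cons e he p ih =>
    rcases List.mem_cons.1 hz with rfl | hz
    exacts [he.left_mem, ih hz]

lemma mem_support_of_inc {x y z : α} {e : β} (p : G.Walk x y) (he : e ∈ p.edges)
    (hz : G.Inc e z) : z ∈ p.support := by
  induction p with
  | nil => simp [edges] at he
  | cons f hf p ih =>
    rcases List.mem_cons.1 he with rfl | he
    · rcases hz.eq_or_eq_of_isLink hf with rfl | rfl
      exacts [List.mem_cons_self, List.mem_cons_of_mem _ p.start_mem_support]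
    · exact List.mem_cons_of_mem _ (ih he)

lemma mem_edgeSet_of_mem_edges {x y : α} {e : β} (p : G.Walk x y) (he : e ∈ p.edges) :
    e ∈ G.edgeSet := by
  induction p with
  | nil => simp [edges] at he
  | cons f hf p ih =>
    rcases List.mem_cons.1 he with rfl | he
    exacts [hf.edge_mem, ih he]

lemma mem_iff_of_edges_disjoint_boundary {P : Set α} {x y z : α} (p : G.Walk x y)
    (hp : ∀ e ∈ p.edges, e ∉ G.boundary P) (hz : z ∈ p.support) : z ∈ P ↔ x ∈ P := by
  induction p with
  | nil =>
    obtain rfl := List.mem_singleton.1 hz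
    rfl
  | @cons x y _ e he p ih =>
    rcases List.mem_cons.1 hz with rfl | hz
    · rfl
    have h := hp e List.mem_cons_self
    rw [ih (fun f hf => hp f (List.mem_cons_of_mem _ hf)) hz]
    exact ⟨fun hy => by_contra fun hx => h ⟨y, x, he.symm, hy, hx⟩,
      fun hx => by_contra fun hy => h ⟨x, y, he, hx, hy⟩⟩

lemma edges_nonempty {x y : α} (p : G.Walk x y) (hxy : x ≠ y) : ∃ e, e ∈ p.edges := by
  cases p with
  | nil => exact absurd rfl hxy
  | cons e he p => exact ⟨e, List.mem_cons_self⟩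

/-- A path has at most two edges at any vertex. -/
lemma encard_edges_inc_le {x y : α} (p : G.Walk x y) (hp : p.support.Nodup) (z : α) :
    {e | e ∈ p.edges ∧ G.Inc e z}.encard ≤ 2 := by
  -- The sharper bound at the starting vertex is what the induction needs when a first edge is
  -- prepended.
  suffices h : (z = x → {e | e ∈ p.edges ∧ G.Inc e z}.encard ≤ 1) ∧
      {e | e ∈ p.edges ∧ G.Inc e z}.encard ≤ 2 from h.2
  induction p with
  | nil => simp [edges]
  | @cons x y _ e he p ih =>
    rw [support, List.nodup_cons] at hp
    have ih := ih hp.2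
    have hsub : {f | f ∈ (cons e he p).edges ∧ G.Inc f z} ⊆
        insert e {f | f ∈ p.edges ∧ G.Inc f z} := by
      rintro f ⟨hf, hfz⟩
      rcases List.mem_cons.1 hf with rfl | hf
      exacts [Or.inl rfl, Or.inr ⟨hf, hfz⟩]
    have hx : z = x → {f | f ∈ (cons e he p).edges ∧ G.Inc f z}.encard ≤ 1 := by
      rintro rfl
      rw [← Set.encard_singleton e]
      refine Set.encard_le_encard (hsub.trans ?_)
      rintro f (rfl | ⟨hf, hfz⟩)
      exacts [rfl, absurd (p.mem_support_of_inc hf hfz) hp.1]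
    refine ⟨hx, ?_⟩
    by_cases hzx : z = x
    · exact (hx hzx).trans one_le_two
    by_cases hzy : z = y
    · calc _ ≤ _ := Set.encard_le_encard hsub
        _ ≤ {f | f ∈ p.edges ∧ G.Inc f z}.encard + 1 := Set.encard_insert_le _ _
        _ ≤ 1 + 1 := by gcongr; exact ih.1 hzy
        _ = 2 := one_add_one_eq_two
    · refine (Set.encard_le_encard fun f hf => ?_).trans ih.2
      rcases hsub hf with rfl | h
      · rcases hf.2.eq_or_eq_of_isLink he with h | h
        exacts [absurd h hzx, absurd h hzy]
      · exact h

end Walk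

/-! ### Immersion models -/

/-- A path of a subgraph is a path of the graph. -/
def PathIn.ofLE {G G' : Graph α β} (h : G' ≤ G) (p : G'.PathIn) : G.PathIn :=
  ⟨p.src, p.tgt, p.walk.ofLE h, by simpa using p.nodup⟩

@[simp] lemma PathIn.edges_ofLE {G G' : Graph α β} (h : G' ≤ G) (p : G'.PathIn) :
    (p.ofLE h).edges = p.edges := by simp [edges, ofLE]

@[simp] lemma PathIn.vertices_ofLE {G G' : Graph α β} (h : G' ≤ G) (p : G'.PathIn) :
    (p.ofLE h).vertices = p.vertices := by simp [vertices, ofLE]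

namespace ImmersionModel

variable {H : Graph α' β'} {G G' : Graph α β}

/-- The vertices of the expansion of a model. -/
def vertices (m : ImmersionModel H G) : Set α :=
  Set.range (fun x => (m.φ x : α)) ∪ ⋃ e, (m.ψ e).vertices

/-- The edges of the expansion of a model. -/
def edges (m : ImmersionModel H G) : Set β := ⋃ e, (m.ψ e).edges

/-- A model in a subgraph is a model in the graph. -/
def ofLE (h : G' ≤ G) (m : ImmersionModel H G') : ImmersionModel H G where
  φ := m.φ.trans ⟨Set.inclusion h.vertexSet_mono, Set.inclusion_injective _⟩
  ψ e := (m.ψ e).ofLE h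
  ends := m.ends
  edgeDisjoint e f hef := by simpa using m.edgeDisjoint e f hef

@[simp] lemma edges_ofLE (h : G' ≤ G) (m : ImmersionModel H G') : (m.ofLE h).edges = m.edges := by
  simp [edges, ofLE]

@[simp] lemma vertices_ofLE (h : G' ≤ G) (m : ImmersionModel H G') :
    (m.ofLE h).vertices = m.vertices := by
  simp [vertices, ofLE]

variable (m : ImmersionModel H G)

lemma mem_edges {e : β} : e ∈ m.edges ↔ ∃ i, e ∈ (m.ψ i).walk.edges := by
  simp [edges, PathIn.edges]

lemma vertices_subset : m.vertices ⊆ G.vertexSet := by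
  rintro x (⟨y, rfl⟩ | hx)
  · exact (m.φ y).2
  · obtain ⟨i, hi⟩ := Set.mem_iUnion.1 hx
    exact (m.ψ i).walk.mem_vertexSet_of_mem_support hi

lemma edges_subset : m.edges ⊆ G.edgeSet := by
  intro e he
  obtain ⟨i, hi⟩ := m.mem_edges.1 he
  exact (m.ψ i).walk.mem_edgeSet_of_mem_edges hi

lemma mem_vertices_of_inc {e : β} {x : α} (he : e ∈ m.edges) (hx : G.Inc e x) :
    x ∈ m.vertices := by
  obtain ⟨i, hi⟩ := m.mem_edges.1 he
  exact Or.inr (Set.mem_iUnion.2 ⟨i, (m.ψ i).walk.mem_support_of_inc hi hx⟩)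

/-- An edge of the loopless graph `H` has distinct ends, so its path is nontrivial. Hence
edge-disjoint expansions are distinct, and packings are bounded in size. -/
lemma edges_nonempty (hL : H.Loopless) (hE : H.edgeSet.Nonempty) : m.edges.Nonempty := by
  obtain ⟨e, he⟩ := hE
  obtain ⟨x, y, hxy⟩ := exists_isLink_of_mem_edgeSet he
  have h := m.ends ⟨e, he⟩ ⟨x, hxy.left_mem⟩ ⟨y, hxy.right_mem⟩ hxy
  have hne : (m.ψ ⟨e, he⟩).src ≠ (m.ψ ⟨e, he⟩).tgt := by
    intro hst
    rw [hst, Sym2.eq_iff] at h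
    have h' : m.φ ⟨x, hxy.left_mem⟩ = m.φ ⟨y, hxy.right_mem⟩ := by
      apply Subtype.ext
      rcases h with ⟨h1, h2⟩ | ⟨h1, h2⟩
      exacts [h1.symm.trans h2, h2.symm.trans h1]
    have h'' := congrArg Subtype.val (m.φ.injective h')
    exact hL.not_isLoopAt _ _ ((show x = y from h'') ▸ hxy)
  obtain ⟨f, hf⟩ := (m.ψ ⟨e, he⟩).walk.edges_nonempty hne
  exact ⟨f, m.mem_edges.2 ⟨_, hf⟩⟩

/-- A model of a connected graph that does not cross the boundary of `P` lies on one side. -/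
lemma vertices_subset_of_disjoint_boundary (hH : H.IsConnected) {P : Set α}
    (hP : Disjoint m.edges (G.boundary P)) {z : α} (hz : z ∈ m.vertices) (hzP : z ∈ P) :
    m.vertices ⊆ P := by
  have hpath : ∀ i z, z ∈ (m.ψ i).walk.support → (z ∈ P ↔ (m.ψ i).src ∈ P) := fun i z hz =>
    (m.ψ i).walk.mem_iff_of_edges_disjoint_boundary
      (fun e he => Set.disjoint_left.1 hP (m.mem_edges.2 ⟨i, he⟩)) hz
  have hlink : ∀ (i : H.edgeSet) (x y : H.vertexSet), H.IsLink i x y →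
      (((m.φ x : α) ∈ P ↔ (m.ψ i).src ∈ P) ∧ ((m.φ y : α) ∈ P ↔ (m.ψ i).src ∈ P)) := by
    intro i x y hxy
    have h1 := hpath i _ (m.ψ i).walk.end_mem_support
    have h2 := m.ends i x y hxy
    rw [Sym2.eq_iff] at h2
    rcases h2 with ⟨h2, h3⟩ | ⟨h2, h3⟩
    · exact ⟨h2 ▸ Iff.rfl, h3 ▸ h1⟩
    · exact ⟨h3 ▸ h1, h2 ▸ Iff.rfl⟩
  have hwalk : ∀ {x y : α'} (_ : H.Walk x y) (hx : x ∈ H.vertexSet) (hy : y ∈ H.vertexSet),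
      ((m.φ ⟨x, hx⟩ : α) ∈ P ↔ (m.φ ⟨y, hy⟩ : α) ∈ P) := by
    intro x y p
    induction p with
    | nil => exact fun _ _ => Iff.rfl
    | cons e he p ih =>
      intro hx hz
      have h := hlink ⟨e, he.edge_mem⟩ ⟨_, hx⟩ ⟨_, he.right_mem⟩ he
      exact (h.1.trans h.2.symm).trans (ih he.right_mem hz)
  have hall : ∀ x y, ((m.φ x : α) ∈ P ↔ (m.φ y : α) ∈ P) := fun x y =>
    (hH.2 x x.2 y y.2).elim fun p => hwalk p x.2 y.2
  have hex : ∀ i : H.edgeSet, ∃ x, ((m.φ x : α) ∈ P ↔ (m.ψ i).src ∈ P) := by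
    intro i
    obtain ⟨x, y, hxy⟩ := exists_isLink_of_mem_edgeSet i.2
    exact ⟨_, (hlink i ⟨x, hxy.left_mem⟩ ⟨y, hxy.right_mem⟩ hxy).1⟩
  have hφ : ∃ x, (m.φ x : α) ∈ P := by
    rcases hz with ⟨x, rfl⟩ | hz
    · exact ⟨x, hzP⟩
    · obtain ⟨i, hi⟩ := Set.mem_iUnion.1 hz
      obtain ⟨x, hx⟩ := hex i
      exact ⟨x, hx.2 ((hpath i z hi).1 hzP)⟩
  obtain ⟨x₀, hx₀⟩ := hφ
  rintro w (⟨x, rfl⟩ | hw)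
  · exact (hall x₀ x).1 hx₀
  · obtain ⟨i, hi⟩ := Set.mem_iUnion.1 hw
    obtain ⟨x, hx⟩ := hex i
    exact (hpath i w hi).2 (hx.1 ((hall x₀ x).1 hx₀))

/-- The expansion of a model. -/
def expansion : Graph α β := (G.restrict m.edges).induce m.vertices

lemma expansion_le : m.expansion ≤ G :=
  (induce_le (G := G.restrict m.edges) m.vertices_subset).trans restrict_le

lemma edgeSet_expansion : m.expansion.edgeSet = m.edges := by
  ext e
  simp only [expansion, edgeSet_induce, restrict_isLink, Set.mem_ofPred_eq]
  constructor
  · rintro ⟨x, y, ⟨he, -⟩, -⟩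
    exact he
  · intro he
    obtain ⟨x, y, hxy⟩ := exists_isLink_of_mem_edgeSet (m.edges_subset he)
    exact ⟨x, y, by tauto, m.mem_vertices_of_inc he ⟨y, hxy⟩,
      m.mem_vertices_of_inc he ⟨x, hxy.symm⟩⟩

lemma isImmersionExpansion_expansion : IsImmersionExpansion H G m.expansion :=
  ⟨m.expansion_le, m, rfl, m.edgeSet_expansion⟩

end ImmersionModel

lemma IsImmersionExpansion.of_le {H : Graph α' β'} {G G' M : Graph α β} (h : G' ≤ G)
    (hM : IsImmersionExpansion H G' M) : IsImmersionExpansion H G M := by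
  obtain ⟨hM, m, hV, hE⟩ := hM
  exact ⟨hM.trans h, m.ofLE h, hV.trans (m.vertices_ofLE h).symm, hE.trans (m.edges_ofLE h).symm⟩

/-- The graph `H` is immersed in `G` using only vertices from `P`. -/
def ImmersedIn (H : Graph α' β') (G : Graph α β) (P : Set α) : Prop :=
  ∃ m : ImmersionModel H G, m.vertices ⊆ P

/-- A criterion for all models that avoid `C` to be edge-disjoint from a given model. -/
lemma ImmersionModel.disjoint_edges_of_boundary_subset {H : Graph α' β'} {G G' : Graph α β}
    (hH : H.IsConnected) (hG : G' ≤ G) (m : ImmersionModel H G') {C : Set β}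
    (h : ∀ e ∈ m.edges, e ∉ C →
      ∃ P x, G'.Inc e x ∧ x ∈ P ∧ G.boundary P ⊆ C ∧ ¬ ImmersedIn H G' P)
    (n : ImmersionModel H (G'.deleteEdges C)) : Disjoint m.edges n.edges := by
  rw [Set.disjoint_left]
  intro e hem hen
  have hle : G'.deleteEdges C ≤ G' := deleteEdges_le
  have hC : ∀ f ∈ n.edges, f ∉ C := by
    intro f hf
    have := n.edges_subset hf
    simp at this
    exact this.2
  obtain ⟨P, x, hx, hxP, hP, hno⟩ := h e hem (hC e hen)
  -- A surviving model using `e` meets `P` and cannot cross its deleted boundary, so it would lie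
  -- inside `P`.
  refine hno ⟨n.ofLE hle, (n.ofLE hle).vertices_subset_of_disjoint_boundary hH ?_
    ((n.ofLE hle).mem_vertices_of_inc (by simpa using hen) hx) hxP⟩
  rw [edges_ofLE, Set.disjoint_left]
  rintro f hf ⟨x, y, hxy, hx, hy⟩
  exact hC f hf (hP ⟨x, y, hxy.mono hG, hx, hy⟩)

/-- The edges of a model at a set of vertices. -/
lemma ImmersionModel.encard_edges_inc_le {H : Graph α' β'} {G : Graph α β}
    (m : ImmersionModel H G) (hE : H.edgeSet.Finite) {X : Set α} (hX : X.Finite) :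
    {e | e ∈ m.edges ∧ ∃ x ∈ X, G.Inc e x}.encard ≤
      (2 * X.ncard * H.edgeSet.ncard : ℕ) := by
  classical
  have := hE.fintype
  have h1 : {e | e ∈ m.edges ∧ ∃ x ∈ X, G.Inc e x} =
      ⋃ q ∈ hX.toFinset ×ˢ (Finset.univ : Finset H.edgeSet),
        {e | e ∈ (m.ψ q.2).walk.edges ∧ G.Inc e q.1} := by
    ext e
    simp only [Set.mem_ofPred_eq, m.mem_edges, Set.mem_iUnion, Finset.mem_product,
      Set.Finite.mem_toFinset, Finset.mem_univ, and_true, Prod.exists, exists_prop]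
    constructor
    · rintro ⟨⟨i, hi⟩, x, hx, hex⟩
      exact ⟨x, i, hx, hi, hex⟩
    · rintro ⟨x, i, hx, hi, hex⟩
      exact ⟨⟨i, hi⟩, x, hx, hex⟩
  rw [h1]
  have h2 := Set.encard_biUnion_le_mul (hX.toFinset ×ˢ (Finset.univ : Finset H.edgeSet))
    (fun q => {e | e ∈ (m.ψ q.2).walk.edges ∧ G.Inc e q.1}) 2
    fun q _ => (m.ψ q.2).walk.encard_edges_inc_le (m.ψ q.2).nodup q.1
  refine h2.trans (le_of_eq ?_)
  rw [Finset.card_product, Finset.card_univ, ← Set.ncard_eq_toFinset_card X hX,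
    Fintype.card_eq_nat_card, Nat.card_coe_set_eq]
  congr 1
  ring

end Graph

/-! ### Small cuts from a tree-cut decomposition. -/

namespace Graph

variable {α β α' β' : Type*}

lemma _root_.Relation.ReflTransGen.exists_step {γ : Type*} {R : γ → γ → Prop} {p : γ → Prop}
    {a b : γ} (h : Relation.ReflTransGen R a b) (ha : p a) (hb : ¬ p b) :
    ∃ c d, Relation.ReflTransGen R a c ∧ R c d ∧ p c ∧ ¬ p d := by
  induction h with
  | refl => exact absurd ha hb
  | @tail c d hac hcd ih =>
    by_cases hc : p c
    exacts [⟨c, d, hac, hcd, hc, hb⟩, ih hc]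

lemma boundary_compl (G : Graph α β) (S : Set α) : G.boundary Sᶜ = G.boundary S := by
  ext e
  constructor
  · rintro ⟨x, y, h, hx, hy⟩
    exact ⟨y, x, h.symm, not_not.1 hy, hx⟩
  · rintro ⟨x, y, h, hx, hy⟩
    exact ⟨y, x, h.symm, hy, not_not.2 hx⟩

lemma mem_boundary_of_ne {G : Graph α β} {γ : Type*} {f : α → γ} {e : β} {x y : α}
    (h : G.IsLink e x y) (hxy : f x ≠ f y) : e ∈ G.boundary (f ⁻¹' {f x}) :=
  ⟨x, y, h, rfl, hxy.symm⟩

namespace TreeCutDecomposition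

variable {G G' : Graph α β} {H : Graph α' β'} {ι : Type} (D : G.TreeCutDecomposition ι)

/-- The union of the bags of the descendants of `t` (up to elements that are not vertices). -/
def below (t : ι) : Set α := {x | D.node x ∈ D.desc t}

variable {D} {t : ι}

lemma encard_boundary_below (hG : G.edgeSet.Finite) (t : ι) :
    (G.boundary (D.below t)).encard = D.adhesion t :=
  ((hG.subset (boundary_subset_edgeSet _ _)).cast_ncard_eq).symm

lemma torsoMap_eq_inr_iff {x : α} {c : (D.tree.induce {t}ᶜ).ConnectedComponent} :
    D.torsoMap t x = Sum.inr c ↔ D.InComp t c (D.node x) := by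
  unfold torsoMap InComp
  split_ifs with h
  · simp [h]
  · simp [h]

lemma node_eq_of_torsoMap_eq_inl {x y : α} (h : D.torsoMap t x = Sum.inl y) : D.node x = t := by
  unfold torsoMap at h
  split_ifs at h with h'
  exact h'

lemma torsoMap_mem_vertexSet {x : α} (hx : x ∈ G.vertexSet) :
    D.torsoMap t x ∈ (D.torso t).vertexSet := by
  unfold torsoMap torso
  split_ifs with h
  · exact Or.inl ⟨x, ⟨hx, h⟩, rfl⟩
  · exact Or.inr ⟨_, rfl⟩

lemma torso_isLink {e : β} {x y : α} (h : G.IsLink e x y)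
    (hxy : D.torsoMap t x ≠ D.torsoMap t y) :
    (D.torso t).IsLink e (D.torsoMap t x) (D.torsoMap t y) :=
  ⟨hxy, x, y, h, rfl, rfl⟩

lemma torso_not_isLink_self (e : β) (a) : ¬ (D.torso t).IsLink e a a := fun h => h.1 rfl

/-- The torso keeps edge names and loses only edges inside a fibre, which cross no preimage; cuts of
the torso are therefore literally cuts of `G`. -/
lemma boundary_preimage_torsoMap (S : Set (α ⊕ (D.tree.induce {t}ᶜ).ConnectedComponent)) :
    G.boundary (D.torsoMap t ⁻¹' S) = (D.torso t).boundary S := by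
  ext e
  constructor
  · rintro ⟨x, y, h, hx, hy⟩
    exact ⟨_, _, torso_isLink h (ne_of_mem_of_not_mem (s := S) hx hy), hx, hy⟩
  · rintro ⟨_, _, ⟨-, x, y, h, rfl, rfl⟩, hx, hy⟩
    exact ⟨x, y, h, hx, hy⟩

lemma finite_vertexSet_torso [Finite ι] (hG : G.vertexSet.Finite) :
    (D.torso t).vertexSet.Finite := by
  refine ((hG.subset fun x hx => hx.1).image _).union (Set.finite_range _)

/-- A component of the tree minus `t` below `t` comes from a proper descendant. -/
lemma exists_below_eq_of_mem_below {c : (D.tree.induce {t}ᶜ).ConnectedComponent} {x : α}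
    (hx : x ∈ D.below t) (hc : D.torsoMap t x = Sum.inr c) :
    ∃ s, D.desc s ⊂ D.desc t ∧ D.torsoMap t ⁻¹' {Sum.inr c} = D.below s := by
  have hroot : ¬ D.InComp t c D.root := fun h =>
    (mem_desc_iff_of_root h _).1 hx (torsoMap_eq_inr_iff.1 hc)
  obtain ⟨s, hs, h⟩ := exists_desc_eq_of_not_root hroot
  refine ⟨s, hs, ?_⟩
  ext y
  exact torsoMap_eq_inr_iff.trans (h _).symm

/-- The component containing the root is complementary to the descendants of `t`; any other one is
the set of descendants of some node. Both boundaries are adhesions. -/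
lemma encard_boundary_torsoMap_inr_le (hG : G.edgeSet.Finite) {r : ℕ} (hr : ∀ s, D.adhesion s ≤ r)
    (c : (D.tree.induce {t}ᶜ).ConnectedComponent) :
    (G.boundary (D.torsoMap t ⁻¹' {Sum.inr c})).encard ≤ r := by
  by_cases hroot : D.InComp t c D.root
  · have h : D.torsoMap t ⁻¹' {Sum.inr c} = (D.below t)ᶜ := by
      ext y
      refine torsoMap_eq_inr_iff.trans ?_
      rw [Set.mem_compl_iff, below, Set.mem_ofPred_eq, mem_desc_iff_of_root hroot, not_not]
    rw [h, boundary_compl, encard_boundary_below hG]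
    exact_mod_cast hr t
  · obtain ⟨s, -, h⟩ := exists_desc_eq_of_not_root hroot
    have h : D.torsoMap t ⁻¹' {Sum.inr c} = D.below s := by
      ext y
      exact torsoMap_eq_inr_iff.trans (h _).symm
    rw [h, encard_boundary_below hG]
    exact_mod_cast hr s

/-- The vertices below `t` whose torso vertex lies in the class of `a` among the torso vertices
outside `K`. -/
def classBelow (D : G.TreeCutDecomposition ι) (t : ι)
    (K : Set (α ⊕ (D.tree.induce {t}ᶜ).ConnectedComponent))
    (a : α ⊕ (D.tree.induce {t}ᶜ).ConnectedComponent) : Set α :=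
  D.torsoMap t ⁻¹' (D.torso t).classAvoiding K a ∩ D.below t

/-- The reduction step that first leaves behind a component containing an immersion yields a small
cut. -/
lemma exists_cut_of_centerStep (hH : H.IsConnected) (hGE : G.edgeSet.Finite) {r : ℕ}
    (hr : ∀ s, D.adhesion s ≤ r) (hle : G' ≤ G)
    (hmin : ∀ s, D.desc s ⊂ D.desc t → ¬ ImmersedIn H G' (D.below s)) {C C'}
    (hC : Relation.ReflTransGen (CenterStep (Sum.inl '' D.bag t)) (D.torso t) C)
    (hstep : CenterStep (Sum.inl '' D.bag t) C C')
    (hQ : ∀ a ∈ (D.torso t).vertexSet, a ∉ C.vertexSet →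
      ¬ ImmersedIn H G' (D.classBelow t C.vertexSet a))
    {a} (ha : a ∈ (D.torso t).vertexSet) (haC : a ∉ C'.vertexSet)
    (m : ImmersionModel H G') (hm : m.vertices ⊆ D.classBelow t C'.vertexSet a) :
    ∃ S ⊆ G.edgeSet, S.encard ≤ (2 * r + 2 : ℕ) ∧
      ∀ n : ImmersionModel H (G'.deleteEdges S), Disjoint m.edges n.edges := by
  obtain ⟨v, hv, hvX, hV⟩ := hstep.exists_vertexSet_eq
  -- The reduction never removes vertices of the bag, so `v` stands for a component of the tree
  -- minus `t`.
  obtain ⟨c, rfl⟩ : ∃ c, v = Sum.inr c := by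
    rcases CenterStep.vertexSet_subset hC hv with h | ⟨c, rfl⟩
    exacts [absurd h hvX, ⟨c, rfl⟩]
  set A := (D.torso t).classAvoiding C'.vertexSet a with hA
  set S := G.boundary (D.below t) ∪ G.boundary (D.torsoMap t ⁻¹' {Sum.inr c}) ∪
    G.boundary (D.torsoMap t ⁻¹' A) with hS
  have hS₁ : G.boundary (D.below t) ⊆ S := fun e h => Or.inl (Or.inl h)
  have hS₂ : G.boundary (D.torsoMap t ⁻¹' {Sum.inr c}) ⊆ S := fun e h => Or.inl (Or.inr h)
  have hS₃ : G.boundary (D.torsoMap t ⁻¹' A) ⊆ S := fun e h => Or.inr h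
  refine ⟨S, Set.union_subset (Set.union_subset ?_ ?_) ?_, ?_,
    m.disjoint_edges_of_boundary_subset hH hle ?_⟩
  · exact boundary_subset_edgeSet _ _
  · exact boundary_subset_edgeSet _ _
  · exact boundary_subset_edgeSet _ _
  · calc S.encard ≤ (G.boundary (D.below t)).encard +
          (G.boundary (D.torsoMap t ⁻¹' {Sum.inr c})).encard +
          (G.boundary (D.torsoMap t ⁻¹' A)).encard :=
        (Set.encard_union_le _ _).trans (by gcongr; exact Set.encard_union_le _ _)
      _ ≤ r + r + 2 := by
        gcongr
        · rw [encard_boundary_below hGE]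
          exact_mod_cast hr t
        · exact encard_boundary_torsoMap_inr_le hGE hr c
        · rw [boundary_preimage_torsoMap]
          exact CenterStep.encard_boundary_classAvoiding_le (hC.tail hstep)
            torso_not_isLink_self ha haC
      _ = (2 * r + 2 : ℕ) := by push_cast; ring
  · intro e he heS
    obtain ⟨x, y, hxy⟩ := exists_isLink_of_mem_edgeSet (m.edges_subset he)
    obtain ⟨hxA, hxt⟩ := hm (m.mem_vertices_of_inc he ⟨y, hxy⟩)
    by_cases hxc : D.torsoMap t x = Sum.inr c
    · obtain ⟨s, hs, hs'⟩ := exists_below_eq_of_mem_below hxt hxc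
      refine ⟨_, x, ⟨y, hxy⟩, ?_, hS₂, hs' ▸ hmin s hs⟩
      exact hxc
    have hxC : D.torsoMap t x ∉ C.vertexSet := fun h =>
      notMem_of_mem_classAvoiding haC hxA (hV ▸ ⟨h, hxc⟩)
    refine ⟨D.classBelow t C.vertexSet (D.torsoMap t x), x, ⟨y, hxy⟩,
      ⟨mem_classAvoiding_self _ _ _, hxt⟩, ?_,
      hQ _ (torsoMap_mem_vertexSet (hxy.mono hle).left_mem) hxC⟩
    -- An edge leaving an old class inside the region below `t` ends in `C`: either at `c`, or at a
    -- vertex of `C'`, and then it also leaves the new class `A`.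
    rintro f ⟨z, w, hzw, ⟨hz, hzt⟩, hw⟩
    by_cases hwt : w ∈ D.below t
    · have hw : D.torsoMap t w ∉ (D.torso t).classAvoiding C.vertexSet (D.torsoMap t x) :=
        fun h => hw ⟨h, hwt⟩
      have hne : D.torsoMap t z ≠ D.torsoMap t w := ne_of_mem_of_not_mem hz hw
      by_cases hwc : D.torsoMap t w = Sum.inr c
      · refine hS₂ ?_
        rw [← hwc]
        exact mem_boundary_of_ne hzw.symm hne.symm
      have hwC : D.torsoMap t w ∈ C.vertexSet := by_contra fun h =>
        hw (mem_classAvoiding_of_adj hz (torso_isLink hzw hne).adj h)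
      have hsub : C'.vertexSet ⊆ C.vertexSet := hV ▸ Set.sdiff_subset
      refine hS₃ ⟨z, w, hzw, ?_, fun h =>
        notMem_of_mem_classAvoiding haC h (hV ▸ ⟨hwC, hwc⟩)⟩
      rw [hA, ← classAvoiding_eq_of_mem haC hxA]
      exact classAvoiding_anti hsub _ hz
    · exact hS₁ ⟨z, w, hzw, hzt, hwt⟩

/-- If no component outside the 3-center contains an immersion, then an immersion below `t` yields
a small cut. -/
lemma exists_cut_of_isThreeCenter (hH : H.IsConnected) (hHE : H.edgeSet.Finite)
    (hGE : G.edgeSet.Finite) {r : ℕ}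
    (hr : ∀ s, D.adhesion s ≤ r) (hle : G' ≤ G)
    (hmin : ∀ s, D.desc s ⊂ D.desc t → ¬ ImmersedIn H G' (D.below s)) {C}
    (hC : Relation.ReflTransGen (CenterStep (Sum.inl '' D.bag t)) (D.torso t) C)
    (hCfin : C.vertexSet.Finite) (hCr : C.vertexSet.ncard ≤ r)
    (hQ : ∀ a ∈ (D.torso t).vertexSet, a ∉ C.vertexSet →
      ¬ ImmersedIn H G' (D.classBelow t C.vertexSet a))
    (m : ImmersionModel H G') (hm : m.vertices ⊆ D.below t) :
    ∃ S ⊆ G.edgeSet, S.encard ≤ (r + 3 * (2 * r * H.edgeSet.ncard + r * r) : ℕ) ∧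
      ∀ n : ImmersionModel H (G'.deleteEdges S), Disjoint m.edges n.edges := by
  classical
  have hX : Sum.inl '' D.bag t ⊆ C.vertexSet := CenterStep.subset_vertexSet hC fun x hx => Or.inl hx
  have hbag : (D.bag t).Finite := (hCfin.subset hX).of_finite_image Sum.inl_injective.injOn
  have hbagr : (D.bag t).ncard ≤ r := by
    rw [← Set.ncard_image_of_injective _
      (Sum.inl_injective (β := (D.tree.induce {t}ᶜ).ConnectedComponent))]
    exact (Set.ncard_le_ncard hX hCfin).trans hCr
  have hK : {c | Sum.inr c ∈ C.vertexSet}.Finite :=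
    hCfin.preimage Sum.inr_injective.injOn
  have hKr : hK.toFinset.card ≤ r := by
    rw [← Set.ncard_eq_toFinset_card _ hK,
      ← Set.ncard_image_of_injective _ (Sum.inr_injective (α := α))]
    refine (Set.ncard_le_ncard ?_ hCfin).trans hCr
    rintro _ ⟨c, hc, rfl⟩
    exact hc
  -- Degrees at the bag are unbounded, so only edges of `m` are taken there: at most two per bag
  -- vertex and edge of `H`.
  set F₁ := {e | e ∈ m.edges ∧ ∃ x ∈ D.bag t, G'.Inc e x} with hF₁
  set F₂ := ⋃ c ∈ hK.toFinset, G.boundary (D.torsoMap t ⁻¹' {Sum.inr c}) with hF₂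
  have hF₁r : F₁.encard ≤ (2 * r * H.edgeSet.ncard : ℕ) :=
    (m.encard_edges_inc_le hHE hbag).trans (by gcongr)
  have hF₂r : F₂.encard ≤ (r * r : ℕ) :=
    (Set.encard_biUnion_le_mul _ _ r
      fun c _ => encard_boundary_torsoMap_inr_le hGE hr c).trans (by gcongr)
  have hFr : (F₁ ∪ F₂).encard ≤ (2 * r * H.edgeSet.ncard + r * r : ℕ) :=
    (Set.encard_union_le _ _).trans (by push_cast at *; gcongr)
  have hFfin : (F₁ ∪ F₂).Finite := Set.finite_of_encard_le_coe hFr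
  set A : β → Set β := fun f => {g | ∃ a ∈ (D.torso t).vertexSet, a ∉ C.vertexSet ∧
    f ∈ (D.torso t).boundary ((D.torso t).classAvoiding C.vertexSet a) ∧
    g ∈ (D.torso t).boundary ((D.torso t).classAvoiding C.vertexSet a)} with hA
  -- An edge bounds at most one class: one of its ends is in `C`, and the other end determines the
  -- class.
  have hA2 : ∀ f, (A f).encard ≤ 2 := by
    intro f
    by_cases h : ∃ a ∈ (D.torso t).vertexSet, a ∉ C.vertexSet ∧
        f ∈ (D.torso t).boundary ((D.torso t).classAvoiding C.vertexSet a)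
    · obtain ⟨a, ha, haC, hf⟩ := h
      refine (Set.encard_le_encard ?_).trans
        (CenterStep.encard_boundary_classAvoiding_le hC torso_not_isLink_self ha haC)
      rintro g ⟨b, hb, hbC, hf', hg⟩
      obtain ⟨x, y, hxy, hx, hy⟩ := mem_boundary_classAvoiding hf
      obtain ⟨x', y', hxy', hx', hy'⟩ := mem_boundary_classAvoiding hf'
      have hxx : x = x' := (hxy.left_eq_or_eq hxy').resolve_right
        fun h => notMem_of_mem_classAvoiding haC hx (h ▸ hy')
      rw [← classAvoiding_eq_of_mem haC hx, hxx, classAvoiding_eq_of_mem hbC hx']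
      exact hg
    · refine (Set.encard_le_encard (t := ∅) ?_).trans (by simp)
      rintro g ⟨a, ha, haC, hf, -⟩
      exact h ⟨a, ha, haC, hf⟩
  set S := G.boundary (D.below t) ∪ (F₁ ∪ F₂) ∪ ⋃ f ∈ hFfin.toFinset, A f with hS
  have hS₁ : G.boundary (D.below t) ⊆ S := fun e h => Or.inl (Or.inl h)
  have hS₂ : F₁ ∪ F₂ ⊆ S := fun e h => Or.inl (Or.inr h)
  have hS₃ : ∀ f ∈ F₁ ∪ F₂, A f ⊆ S := fun f hf e h =>
    Or.inr (Set.mem_biUnion (by simpa using hf) h)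
  have hfib : ∀ c, Sum.inr c ∈ C.vertexSet → G.boundary (D.torsoMap t ⁻¹' {Sum.inr c}) ⊆ F₂ :=
    fun c hc e he => Set.mem_biUnion (x := c) (by simpa using hc) he
  refine ⟨S, Set.union_subset (Set.union_subset ?_ (Set.union_subset ?_ ?_)) ?_, ?_,
    m.disjoint_edges_of_boundary_subset hH hle ?_⟩
  · exact boundary_subset_edgeSet _ _
  · exact fun e he => hle.edgeSet_mono (m.edges_subset he.1)
  · exact Set.iUnion₂_subset fun c _ => boundary_subset_edgeSet _ _
  · refine Set.iUnion₂_subset fun f _ => ?_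
    rintro g ⟨a, -, -, -, hg⟩
    rw [← boundary_preimage_torsoMap] at hg
    exact boundary_subset_edgeSet _ _ hg
  · have h3 : (⋃ f ∈ hFfin.toFinset, A f).encard ≤
        ((2 * r * H.edgeSet.ncard + r * r) * 2 : ℕ) := by
      refine (Set.encard_biUnion_le_mul _ _ 2 fun f _ => hA2 f).trans ?_
      rw [hFfin.encard_eq_coe_toFinset_card] at hFr
      norm_cast at hFr ⊢
      omega
    calc S.encard ≤ (G.boundary (D.below t)).encard + (F₁ ∪ F₂).encard +
          (⋃ f ∈ hFfin.toFinset, A f).encard :=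
        (Set.encard_union_le _ _).trans (by gcongr; exact Set.encard_union_le _ _)
      _ ≤ r + (2 * r * H.edgeSet.ncard + r * r : ℕ) +
          ((2 * r * H.edgeSet.ncard + r * r) * 2 : ℕ) := by
        gcongr
        rw [encard_boundary_below hGE]
        exact_mod_cast hr t
      _ = (r + 3 * (2 * r * H.edgeSet.ncard + r * r) : ℕ) := by push_cast; ring
  · have key : ∀ e x y, e ∈ m.edges → e ∉ S → G'.IsLink e x y → x ∈ D.below t →
        y ∈ D.below t → (∃ c, D.torsoMap t x = Sum.inr c) ∧
          (D.torsoMap t x ∈ C.vertexSet → ∃ P x, G'.Inc e x ∧ x ∈ P ∧ G.boundary P ⊆ S ∧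
            ¬ ImmersedIn H G' P) := by
      intro e x y he heS hxy hx hy
      have hxinr : ∃ c, D.torsoMap t x = Sum.inr c := by
        rcases h : D.torsoMap t x with z | c
        · exact absurd (hS₂ (Or.inl ⟨he, x, ⟨(hxy.mono hle).left_mem,
            node_eq_of_torsoMap_eq_inl h⟩, y, hxy⟩)) heS
        · exact ⟨c, rfl⟩
      refine ⟨hxinr, fun hxC => ?_⟩
      obtain ⟨c, hc⟩ := hxinr
      obtain ⟨s, hs, hs'⟩ := exists_below_eq_of_mem_below hx hc
      refine ⟨D.torsoMap t ⁻¹' {Sum.inr c}, x, ⟨y, hxy⟩, hc, ?_, hs' ▸ hmin s hs⟩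
      exact (hfib c (hc ▸ hxC)).trans (Set.subset_union_right.trans hS₂)
    intro e he heS
    obtain ⟨x, y, hxy⟩ := exists_isLink_of_mem_edgeSet (m.edges_subset he)
    have hxm := m.mem_vertices_of_inc he ⟨y, hxy⟩
    have hxt := hm hxm
    have hyt := hm (m.mem_vertices_of_inc he ⟨x, hxy.symm⟩)
    by_cases hxC : D.torsoMap t x ∈ C.vertexSet
    · exact (key e x y he heS hxy hxt hyt).2 hxC
    have hxV : D.torsoMap t x ∈ (D.torso t).vertexSet :=
      torsoMap_mem_vertexSet (hxy.mono hle).left_mem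
    have hno := hQ _ hxV hxC
    refine ⟨D.classBelow t C.vertexSet (D.torsoMap t x), x, ⟨y, hxy⟩,
      ⟨mem_classAvoiding_self _ _ _, hxt⟩, ?_, hno⟩
    -- A model that never crosses the boundary of this class would lie inside it, contrary to `hQ`.
    -- The crossing edge `f` has an end in the 3-center, so it is in `F₁ ∪ F₂` and its class is cut
    -- off by `A f`.
    obtain ⟨f, hf, hfb⟩ : ∃ f ∈ m.edges, f ∈ (D.torso t).boundary
        ((D.torso t).classAvoiding C.vertexSet (D.torsoMap t x)) := by
      by_contra! hcon
      refine hno ⟨m, Set.subset_inter (m.vertices_subset_of_disjoint_boundary hH ?_ hxm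
        (mem_classAvoiding_self _ _ _)) hm⟩
      rw [Set.disjoint_left]
      rintro f hf ⟨z, w, hzw, hz, hw⟩
      refine hcon f hf ?_
      rw [← boundary_preimage_torsoMap]
      exact ⟨z, w, hzw.mono hle, hz, hw⟩
    have hfF : f ∈ F₁ ∪ F₂ := by
      obtain ⟨_, _, ⟨hne, z, w, hzw, rfl, rfl⟩, hz, hw⟩ := mem_boundary_classAvoiding hfb
      have hzw' : G'.IsLink f z w := (hle.isLink_iff (m.edges_subset hf)).2 hzw
      rcases h : D.torsoMap t w with u | c
      · exact Or.inl ⟨hf, w, ⟨hzw.right_mem, node_eq_of_torsoMap_eq_inl h⟩, z, hzw'.symm⟩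
      · refine Or.inr (hfib c (h ▸ hw) ?_)
        rw [← h]
        exact mem_boundary_of_ne hzw.symm hne.symm
    rintro g ⟨z, w, hzw, ⟨hz, hzt⟩, hw⟩
    by_cases hwt : w ∈ D.below t
    · refine hS₃ f hfF ⟨_, hxV, hxC, hfb, ?_⟩
      rw [← boundary_preimage_torsoMap]
      exact ⟨z, w, hzw, hz, fun h => hw ⟨h, hwt⟩⟩
    · exact hS₁ ⟨z, w, hzw, hzt, hwt⟩

/-- In a graph with a tree-cut decomposition of width at most `r`, every subgraph that contains an
immersion contains a model that can be separated from all other models by few edges. -/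
lemma exists_model_and_cut [Finite ι] (D : G.TreeCutDecomposition ι) (hH : H.IsConnected)
    (hHE : H.edgeSet.Finite) (hGV : G.vertexSet.Finite) (hGE : G.edgeSet.Finite) {r : ℕ}
    (hr : ∀ s, D.adhesion s ≤ r)
    (hr' : ∀ s, threeCenterCard (Sum.inl '' D.bag s) (D.torso s) ≤ r) (hle : G' ≤ G)
    (hG' : ContainsImmersion H G') :
    ∃ m : ImmersionModel H G', ∃ S ⊆ G.edgeSet,
      S.encard ≤ (6 * r * H.edgeSet.ncard + (3 * r * r + 3 * r + 2) : ℕ) ∧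
      ∀ n : ImmersionModel H (G'.deleteEdges S), Disjoint m.edges n.edges := by
  obtain ⟨m₀⟩ := hG'
  have hne : {t | ImmersedIn H G' (D.below t)}.Nonempty :=
    ⟨D.root, m₀, fun x _ => by simp [below, desc_root]⟩
  obtain ⟨t, ⟨m, hm⟩, ht⟩ := Set.exists_min_image _ (fun t => (D.desc t).ncard) (Set.toFinite _) hne
  have hmin : ∀ s, D.desc s ⊂ D.desc t → ¬ ImmersedIn H G' (D.below s) := fun s hs h =>
    absurd (Set.ncard_lt_ncard hs (Set.toFinite _)) (not_lt.2 (ht s h))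
  have hfin := finite_vertexSet_torso (D := D) (t := t) hGV
  obtain ⟨C, ⟨hC, -⟩, hCr⟩ := exists_isThreeCenter_ncard_eq (Sum.inl '' D.bag t) (D.torso t) hfin
  by_cases hQ : ∀ a ∈ (D.torso t).vertexSet, a ∉ C.vertexSet →
      ¬ ImmersedIn H G' (D.classBelow t C.vertexSet a)
  · obtain ⟨S, hS, hSr, h⟩ := exists_cut_of_isThreeCenter hH hHE hGE hr hle hmin hC
      (hfin.subset (CenterStep.vertexSet_subset hC)) (hCr ▸ hr' t) hQ m hm
    exact ⟨m, S, hS, hSr.trans (by norm_cast; nlinarith), h⟩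
  -- The property holds vacuously for the full torso, where nothing has been removed, and fails at
  -- the 3-center; some step destroys it.
  · obtain ⟨C₁, C₂, hC₁, hstep, h₁, h₂⟩ := hC.exists_step
      (p := fun C => ∀ a ∈ (D.torso t).vertexSet, a ∉ C.vertexSet →
        ¬ ImmersedIn H G' (D.classBelow t C.vertexSet a))
      (fun a ha ha' => absurd ha ha') hQ
    push Not at h₂
    obtain ⟨a, ha, haC, m, hm⟩ := h₂
    obtain ⟨S, hS, hSr, h⟩ := exists_cut_of_centerStep hH hGE hr hle hmin hC₁ hstep h₁ ha haC m hm
    exact ⟨m, S, hS, hSr.trans (by norm_cast; nlinarith), h⟩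

end TreeCutDecomposition
end Graph

/-! ### From separable models to packings and covers, and the numerical bound. -/

namespace Graph

variable {α β α' β' : Type*}

/-- A graph has a tree-cut decomposition of minimum width. -/
lemma exists_treeCutDecomposition_width_eq (G : Graph α β) :
    ∃ (ι : Type) (_ : Fintype ι) (D : G.TreeCutDecomposition ι), D.width = G.treeCutWidth := by
  have hne : {w | ∃ (ι : Type) (_ : Fintype ι) (D : G.TreeCutDecomposition ι),
      D.width = w}.Nonempty :=
    ⟨_, Unit, inferInstance, ⟨⊥, SimpleGraph.IsTree.of_subsingleton, (), fun _ => ()⟩, rfl⟩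
  exact Nat.sInf_mem hne

/-- Each expansion owns an edge. The bound is needed because the supremum in `packNum` is meaningful
only for a bounded set. -/
lemma IsImmersionPacking.card_le {H : Graph α' β'} {G : Graph α β} (hL : H.Loopless)
    (hE : H.edgeSet.Nonempty) (hG : G.edgeSet.Finite) {P : Finset (Graph α β)}
    (hP : IsImmersionPacking H G P) : P.card ≤ G.edgeSet.ncard := by
  have hne : ∀ M : P, ∃ e, e ∈ M.1.edgeSet := by
    intro M
    obtain ⟨-, m, -, h⟩ := hP.1 M.1 M.2
    obtain ⟨e, he⟩ := m.edges_nonempty hL hE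
    exact ⟨e, h ▸ he⟩
  choose f hf using hne
  rw [Set.ncard_eq_toFinset_card _ hG, ← Finset.card_attach]
  refine Finset.card_le_card_of_injOn f (fun M _ => ?_) fun M _ N _ hMN => ?_
  · simpa using (hP.1 M.1 M.2).1.edgeSet_mono (hf M)
  · by_contra hne
    exact Set.disjoint_left.1 (hP.2 M.1 M.2 N.1 N.2 fun h => hne (Subtype.ext h)) (hf M)
      (hMN ▸ hf N)

/-- An approximate duality between packings and covers, given that every subgraph that contains an
immersion contains a model separated from all others by at most `K` edges. -/
lemma exists_packing_or_cover {H : Graph α' β'} {G : Graph α β} (hL : H.Loopless)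
    (hE : H.edgeSet.Nonempty) {K : ℕ}
    (hK : ∀ G' ≤ G, ContainsImmersion H G' → ∃ m : ImmersionModel H G', ∃ S ⊆ G.edgeSet,
      S.encard ≤ K ∧ ∀ n : ImmersionModel H (G'.deleteEdges S), Disjoint m.edges n.edges)
    (k : ℕ) : ∀ G' ≤ G, (∃ P : Finset (Graph α β), IsImmersionPacking H G' P ∧ P.card = k + 1) ∨
      ∃ C, IsImmersionCover H G' C ∧ C.encard ≤ (K * k : ℕ) := by
  classical
  induction k with
  | zero =>
    intro G' hle
    by_cases h : ContainsImmersion H G'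
    · obtain ⟨m⟩ := h
      refine Or.inl ⟨{m.expansion}, ⟨?_, ?_⟩, rfl⟩
      · simpa using m.isImmersionExpansion_expansion
      · simp
    · exact Or.inr ⟨∅, ⟨Set.empty_subset _, by simpa using h⟩, by simp⟩
  | succ k ih =>
    intro G' hle
    by_cases h : ContainsImmersion H G'
    · obtain ⟨m, S, hS, hSK, hm⟩ := hK G' hle h
      have hle' : G'.deleteEdges S ≤ G' := deleteEdges_le
      rcases ih _ (hle'.trans hle) with ⟨P, hP, hPk⟩ | ⟨C, ⟨hC, hC'⟩, hCk⟩
      · have hdisj : ∀ N ∈ P, Disjoint m.expansion.edgeSet N.edgeSet := by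
          intro N hN
          obtain ⟨-, n, -, hn⟩ := hP.1 N hN
          rw [m.edgeSet_expansion, hn]
          exact hm n
        -- Otherwise the expansion would be edge-disjoint from itself, yet it has an edge.
        have hmP : m.expansion ∉ P := by
          intro h
          have := hdisj _ h
          rw [disjoint_self, m.edgeSet_expansion] at this
          exact (m.edges_nonempty hL hE).ne_empty this
        refine Or.inl ⟨insert m.expansion P, ⟨?_, ?_⟩,
          by rw [Finset.card_insert_of_notMem hmP, hPk]⟩
        · intro M hM
          rcases Finset.mem_insert.1 hM with rfl | hM
          exacts [m.isImmersionExpansion_expansion, (hP.1 M hM).of_le hle']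
        · intro M hM N hN hMN
          rcases Finset.mem_insert.1 hM with rfl | hM <;> rcases Finset.mem_insert.1 hN with rfl | hN
          · exact absurd rfl hMN
          · exact hdisj N hN
          · exact (hdisj M hM).symm
          · exact hP.2 M hM N hN hMN
      -- `S` is a set of edges of `G`, whereas a cover of `G'` may use only edges of `G'`.
      · refine Or.inr ⟨C ∪ (S ∩ G'.edgeSet), ⟨Set.union_subset (hC.trans hle'.edgeSet_mono)
          Set.inter_subset_right, fun ⟨n⟩ => hC' ⟨n.ofLE ⟨?_, ?_⟩⟩⟩, ?_⟩
        · simp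
        · intro e x y he
          simp only [deleteEdges_isLink, Set.mem_union, Set.mem_inter_iff] at he ⊢
          have := he.1.edge_mem
          tauto
        · calc (C ∪ (S ∩ G'.edgeSet)).encard ≤ C.encard + S.encard :=
              (Set.encard_union_le _ _).trans
                (by gcongr; exact Set.inter_subset_left)
            _ ≤ (K * k : ℕ) + K := by gcongr
            _ = (K * (k + 1) : ℕ) := by push_cast; ring
    · exact Or.inr ⟨∅, ⟨Set.empty_subset _, by simpa using h⟩, by simp⟩

lemma le_eight_mul_tcwGap (r : ℕ) : 3 * (r + 1) ^ 4 + 2 * (r + 1) ^ 2 ≤ 8 * tcwGap r := by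
  have h := Nat.le_ceil (((3 * (r + 1) ^ 4 + 2 * (r + 1) ^ 2 : ℕ) : ℚ) / 8)
  rw [div_le_iff₀ (by norm_num)] at h
  have h' : 3 * (r + 1) ^ 4 + 2 * (r + 1) ^ 2 ≤ tcwGap r * 8 := by exact_mod_cast h
  omega

/-- The bound splits into 6r ≤ σ(r) for the part proportional to `e` and 3r² + 3r + 2 ≤ 4σ(r) for
the constant part, which a single vertex of `H` pays for. -/
lemma le_tcwGap_mul (r v e : ℕ) (hv : 1 ≤ v) :
    6 * r * e + (3 * r * r + 3 * r + 2) ≤ tcwGap r * (4 * v + e) := by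
  have h := le_eight_mul_tcwGap r
  have h1 : 6 * r ≤ tcwGap r := by
    have : 48 * r ≤ 3 * (r + 1) ^ 4 + 2 * (r + 1) ^ 2 := by
      rcases r with _ | _ | r
      · simp
      · norm_num
      · ring_nf
        nlinarith [Nat.zero_le (r ^ 4), Nat.zero_le (r ^ 3), Nat.zero_le (r ^ 2)]
    omega
  have h2 : 3 * r * r + 3 * r + 2 ≤ 4 * tcwGap r := by
    have : 2 * (3 * r * r + 3 * r + 2) ≤ 3 * (r + 1) ^ 4 + 2 * (r + 1) ^ 2 := by
      ring_nf
      nlinarith [Nat.zero_le (r ^ 4), Nat.zero_le (r ^ 3), Nat.zero_le (r ^ 2)]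
    omega
  calc 6 * r * e + (3 * r * r + 3 * r + 2) ≤ tcwGap r * e + 4 * tcwGap r * v := by
        gcongr
        exact h2.trans (Nat.le_mul_of_pos_right _ hv)
    _ = _ := by ring

end Graph

theorem theorem4 {α β α' β' : Type*} (H : Graph α' β') (G : Graph α β)
    (hHV : H.vertexSet.Finite) (hHE : H.edgeSet.Finite) (hHL : H.Loopless)
    (hGV : G.vertexSet.Finite) (hGE : G.edgeSet.Finite) (hGL : G.Loopless)
    (hHconn : H.IsConnected) (hHedge : H.edgeSet.Nonempty)
    (r : ℕ) (hG : G.treeCutWidth ≤ r) :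
    Graph.coverNum H G ≤
        Graph.tcwGap r * (4 * H.vertexSet.ncard + H.edgeSet.ncard) * Graph.packNum H G ∧
      ∀ k : ℕ, (∃ P : Finset (Graph α β), Graph.IsImmersionPacking H G P ∧ P.card = k) ∨
        ∃ C : Set β, Graph.IsImmersionCover H G C ∧
          C.ncard ≤ Graph.tcwGap r * (4 * H.vertexSet.ncard + H.edgeSet.ncard) * k := by
  obtain ⟨ι, _, D, hD⟩ := G.exists_treeCutDecomposition_width_eq
  have hwidth : ∀ s, max (D.adhesion s)
      (Graph.threeCenterCard (Sum.inl '' D.bag s) (D.torso s)) ≤ r := fun s =>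
    (Finset.le_sup (f := fun t => max (D.adhesion t)
      (Graph.threeCenterCard (Sum.inl '' D.bag t) (D.torso t))) (Finset.mem_univ s)).trans
      (hD.trans_le hG)
  have hmain := fun k => Graph.exists_packing_or_cover hHL hHedge (G := G)
    (K := Graph.tcwGap r * (4 * H.vertexSet.ncard + H.edgeSet.ncard)) (fun G' hle hG' => by
      obtain ⟨m, S, hS, hSr, h⟩ := D.exists_model_and_cut hHconn hHE hGV hGE
        (fun s => (le_max_left _ _).trans (hwidth s))
        (fun s => (le_max_right _ _).trans (hwidth s)) hle hG'
      refine ⟨m, S, hS, hSr.trans ?_, h⟩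
      exact_mod_cast Graph.le_tcwGap_mul r _ _ ((Set.ncard_pos hHV).2 hHconn.1)) k G le_rfl
  have hncard : ∀ {C : Set β} {n : ℕ}, C.encard ≤ n → C.ncard ≤ n := fun {C n} h => by
    rw [← (Set.finite_of_encard_le_coe h).cast_ncard_eq] at h
    exact_mod_cast h
  constructor
  -- With k equal to the packing number, a packing of size k + 1 is impossible, so the cover
  -- alternative holds with factor exactly k.
  · rcases hmain (Graph.packNum H G) with ⟨P, hP, hPk⟩ | ⟨C, hC, hCk⟩
    · have hbdd : BddAbove {n | ∃ P : Finset (Graph α β),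
          Graph.IsImmersionPacking H G P ∧ P.card = n} := by
        refine ⟨G.edgeSet.ncard, ?_⟩
        rintro _ ⟨P, hP, rfl⟩
        exact hP.card_le hHL hHedge hGE
      have : Graph.packNum H G + 1 ≤ Graph.packNum H G := le_csSup hbdd ⟨P, hP, hPk⟩
      omega
    · exact (Nat.sInf_le (s := {n | ∃ C : Set β, Graph.IsImmersionCover H G C ∧ C.ncard = n})
        ⟨C, hC, rfl⟩).trans (hncard hCk)
  · rintro (_ | k)
    · exact Or.inl ⟨∅, ⟨by simp, by simp⟩, rfl⟩
    · refine (hmain k).imp id fun ⟨C, hC, hCk⟩ => ⟨C, hC, (hncard hCk).trans ?_⟩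
      gcongr
      omega
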